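/- Let $M$ be a smooth $m$-dimensional manifold with a pseudo-Riemannian metric $\eta$, let $\Sigma$ be a smooth (Hausdorff) $n$-dimensional manifold and $f:\Sigma\to M$ a smooth map such that $g=f^*\eta$ is nondegenerate (so $f$ is an immersion; for example the inclusion of a submanifold with nondegenerate induced metric). Let $\{\cdot,\dots,\cdot\}:C^\infty(\Sigma)^{N+1}\to C^\infty(\Sigma)$ be an $\mathbb{R}$-multilinear map which satisfies the Leibniz rule in each argument; such a bracket is local and therefore also acts on locally defined smooth functions. Let $x^1,\dots,x^m$ be local coordinates of $M$, regarded also as functions on $\Sigma$ via $f$, and $u^1,\dots,u^n$ local coordinates of $\Sigma$. For multi-indices $I=(i_1,\dots,i_N)$, $J=(j_1,\dots,j_N)$ put $\{h,\vec x^I\}=\{h,x^{i_1},\dots,x^{i_N}\}$, $\eta_{IJ}=\eta_{i_1j_1}\cdots\eta_{i_Nj_N}$ and $\mathcal{P}^{iI}=\frac{1}{\sqrt{N!}}\{x^i,\vec x^I\}$, and assume that there are $0<\gamma\in C^\infty(\Sigma)$ and $\epsilon\in\{-1,1\}$ with $$\mathcal{P}^{iI}\mathcal{P}^{jJ}\eta_{IJ}=\epsilon\gamma^2g^{ab}(\partial_ax^i)(\partial_bx^j)$$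 on the common domain of the coordinates in $\Sigma$. Define $$\mathcal{D}^{ij}=\tfrac{\epsilon}{\gamma^2}\mathcal{P}^{iI}\mathcal{P}^{jJ}\eta_{IJ},\qquad \mathcal{D}^i(h)=\tfrac{\epsilon}{\gamma^2N!}\{x^i,\vec x^I\}\{h,\vec x^J\}\eta_{IJ},\qquad \Pi^{ij}=\eta^{ij}-\mathcal{D}^{ij},$$ where indices are raised and lowered with $\eta$, and for tensors along $\Sigma$ $$\hat\nabla_kT^{ij}=\mathcal{D}_k(T^{ij})+{\mathcal{D}_k}^l\big(\bar\Gamma^i_{lp}T^{pj}+\bar\Gamma^j_{lp}T^{ip}\big),\qquad \hat\nabla_kT_{ij}=\mathcal{D}_k(T_{ij})-{\mathcal{D}_k}^l\big(\bar\Gamma^p_{li}T_{pj}+\bar\Gamma^p_{lj}T_{ip}\big),$$ with $\bar\Gamma$ the Christoffel symbols of $\eta$. Let $\bar R$ be the curvature tensor of $(M,\eta)$, with $\bar R_{ijkl}=\eta(\bar R(\partial_k,\partial_l)\partial_j,\partial_i)$ and $\bar R(X,Y)Z=\bar\nabla_X\bar\nabla_YZ-\bar\nabla_Y\bar\nabla_XZ-\bar\nabla_{[X,Y]}Z$,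 and let $\operatorname{Ric}$ (the trace $\operatorname{Ric}(X,Y)=\operatorname{tr}(Z\mapsto R(Z,Y)X)$) and $S$ denote the Ricci and scalar curvatures of $(\Sigma,g)$. Then, at every point of the common coordinate domain and for all $X,Y\in T\Sigma$, with $X^i,Y^i$ the components of $df(X),df(Y)$ in the coordinates $x^i$, $$\operatorname{Ric}(X,Y)=\big[\mathcal{D}^{kl}\bar R_{kilj}+(\hat\nabla_k\Pi^{kl})(\hat\nabla_j\Pi_{il})-(\hat\nabla_k\Pi_{li})(\hat\nabla_j\Pi^{lk})\big]X^iY^j,$$ $$S=\mathcal{D}^{ij}\mathcal{D}^{kl}\bar R_{kilj}+(\hat\nabla^k\Pi_{kl})(\hat\nabla_i\Pi^{il})-(\hat\nabla_k\Pi_{il})(\hat\nabla^i\Pi^{kl}).$$ Thus both are expressed through $(N+1)$-brackets, together with the components $\eta_{ij}$, $\bar\Gamma^i_{jk}$, $\bar R_{ijkl}$ of the ambient geometry. Moreover the bracket expressions are the geometric ones, $\mathcal{D}^{ij}=g^{ab}(\partial_ax^i)(\partial_bx^j)$ and $\mathcal{D}^i(h)=g^{ab}(\partial_ax^i)(\partial_bh)$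 for every function $h$ that is smooth near the point, and $\gamma^2$ is determined by the bracket through $n\gamma^2=\epsilon\,\mathcal{P}^{iI}\mathcal{P}^{jJ}\eta_{IJ}\eta_{ij}$. -/

import Mathlib

open scoped Manifold ContDiff Topology

noncomputable section

namespace BracketGeometry

/-! ### Coordinate calculus on `ℝ^d` -/

/-- The partial derivative `∂_a F` at `u`. -/
def pd {d : ℕ} (a : Fin d) (F : EuclideanSpace ℝ (Fin d) → ℝ) (u : EuclideanSpace ℝ (Fin d)) : ℝ :=
  fderiv ℝ F u (EuclideanSpace.single a 1)

/-- The Christoffel symbols `Γ^k_{ij} = ½ h^{kl} (∂_i h_{jl} + ∂_j h_{il} - ∂_l h_{ij})` of the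
Levi-Civita connection of the metric with component matrix `h`. -/
def christoffel {d : ℕ} (h : EuclideanSpace ℝ (Fin d) → Matrix (Fin d) (Fin d) ℝ)
    (k i j : Fin d) (u : EuclideanSpace ℝ (Fin d)) : ℝ :=
  (1 / 2 : ℝ) * ∑ l, (h u)⁻¹ k l *
    (pd i (fun v => h v j l) u + pd j (fun v => h v i l) u - pd l (fun v => h v i j) u)

/-- The components `R^i_{jkl}` of the curvature tensor
`R(X,Y)Z = ∇_X ∇_Y Z - ∇_Y ∇_X Z - ∇_{[X,Y]} Z`, normalized by
`R(∂_k,∂_l)∂_j = R^i_{jkl} ∂_i`. -/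
def curvatureUp {d : ℕ} (h : EuclideanSpace ℝ (Fin d) → Matrix (Fin d) (Fin d) ℝ)
    (i j k l : Fin d) (u : EuclideanSpace ℝ (Fin d)) : ℝ :=
  pd k (christoffel h i l j) u - pd l (christoffel h i k j) u
    + ∑ p, (christoffel h i k p u * christoffel h p l j u
        - christoffel h i l p u * christoffel h p k j u)

/-- The components `R_{ijkl} = h_{ip} R^p_{jkl} = h(R(∂_k,∂_l)∂_j, ∂_i)`. -/
def curvatureLow {d : ℕ} (h : EuclideanSpace ℝ (Fin d) → Matrix (Fin d) (Fin d) ℝ)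
    (i j k l : Fin d) (u : EuclideanSpace ℝ (Fin d)) : ℝ :=
  ∑ p, h u i p * curvatureUp h p j k l u

/-- The components `Ric_{ij} = R^k_{ikj}`, that is `Ric(X,Y) = tr (Z ↦ R(Z,Y)X)`. -/
def ricciComp {d : ℕ} (h : EuclideanSpace ℝ (Fin d) → Matrix (Fin d) (Fin d) ℝ)
    (i j : Fin d) (u : EuclideanSpace ℝ (Fin d)) : ℝ :=
  ∑ k, curvatureUp h k i k j u

/-! ### Metrics on manifolds -/

/-- A (not necessarily continuous) field of bilinear forms on the tangent spaces. -/
abbrev BilinField (d : ℕ) (M : Type*) [TopologicalSpace M]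
    [ChartedSpace (EuclideanSpace ℝ (Fin d)) M] : Type _ :=
  ∀ x : M, LinearMap.BilinForm ℝ (TangentSpace (𝓡 d) x)

section Metric

variable {d : ℕ} {M : Type*} [TopologicalSpace M] [ChartedSpace (EuclideanSpace ℝ (Fin d)) M]

/-- The coordinate vector `∂_i` of the chart `φ`, at the point with coordinates `y`. -/
def coordVec (φ : OpenPartialHomeomorph M (EuclideanSpace ℝ (Fin d)))
    (y : EuclideanSpace ℝ (Fin d)) (i : Fin d) : TangentSpace (𝓡 d) (φ.symm y) :=
  mfderiv (𝓡 d) (𝓡 d) φ.symm y (EuclideanSpace.single i 1 : EuclideanSpace ℝ (Fin d))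

/-- The components `h_{ij} = h(∂_i, ∂_j)` in the chart `φ`, as functions of the coordinates. -/
def metricComp (h : BilinField d M) (φ : OpenPartialHomeomorph M (EuclideanSpace ℝ (Fin d)))
    (y : EuclideanSpace ℝ (Fin d)) : Matrix (Fin d) (Fin d) ℝ :=
  Matrix.of fun i j => h (φ.symm y) (coordVec φ y i) (coordVec φ y j)

/-- The components of a tangent vector in the chart `φ`. -/
def vecComp (φ : OpenPartialHomeomorph M (EuclideanSpace ℝ (Fin d))) {x : M}
    (X : TangentSpace (𝓡 d) x) : EuclideanSpace ℝ (Fin d) :=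
  mfderiv (𝓡 d) (𝓡 d) φ x X

/-- Pseudo-Riemannian metrics: symmetric, nondegenerate and with smooth components in every
chart. -/
structure IsPseudoRiemannian (h : BilinField d M) : Prop where
  symm : ∀ (x : M) (X Y : TangentSpace (𝓡 d) x), h x X Y = h x Y X
  nondegenerate : ∀ x : M, (h x).Nondegenerate
  smooth : ∀ φ ∈ IsManifold.maximalAtlas (𝓡 d) ∞ M, ∀ i j : Fin d,
    ContDiffOn ℝ ∞ (fun y => metricComp h φ y i j) φ.target

/-- The Ricci curvature `Ric(X,Y)`, computed in the chart `φ`. -/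
def ricci (h : BilinField d M) (φ : OpenPartialHomeomorph M (EuclideanSpace ℝ (Fin d))) (x : M)
    (X Y : TangentSpace (𝓡 d) x) : ℝ :=
  ∑ i, ∑ j, ricciComp (metricComp h φ) i j (φ x) * vecComp φ X i * vecComp φ Y j

/-- The scalar curvature `h^{ij} Ric_{ij}`, computed in the chart `φ`. -/
def scalarCurvature (h : BilinField d M) (φ : OpenPartialHomeomorph M (EuclideanSpace ℝ (Fin d)))
    (x : M) : ℝ :=
  ∑ i, ∑ j, (metricComp h φ (φ x))⁻¹ i j * ricciComp (metricComp h φ) i j (φ x)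

end Metric

/-- The induced field of bilinear forms `g(X,Y) = η(df X, df Y)`. -/
def inducedMetric {m n : ℕ} {M : Type*} [TopologicalSpace M]
    [ChartedSpace (EuclideanSpace ℝ (Fin m)) M] {S : Type*} [TopologicalSpace S]
    [ChartedSpace (EuclideanSpace ℝ (Fin n)) S] (η : BilinField m M) (f : S → M) :
    BilinField n S :=
  fun p => (η (f p)).compl₁₂ (mfderiv (𝓡 n) (𝓡 m) f p).toLinearMap
    (mfderiv (𝓡 n) (𝓡 m) f p).toLinearMap

/-! ### Brackets -/

section Bracket

variable {n N : ℕ} {S : Type*} [TopologicalSpace S] [ChartedSpace (EuclideanSpace ℝ (Fin n)) S]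

/-- An `(N+1)`-bracket: a real `(N+1)`-linear map on `C^∞(S)` which is a derivation in each
argument. -/
structure Bracket (n N : ℕ) (S : Type*) [TopologicalSpace S]
    [ChartedSpace (EuclideanSpace ℝ (Fin n)) S] where
  toMultilinearMap :
    MultilinearMap ℝ (fun _ : Fin (N + 1) => C^∞⟮𝓡 n, S; ℝ⟯) C^∞⟮𝓡 n, S; ℝ⟯
  leibniz : ∀ (F : Fin (N + 1) → C^∞⟮𝓡 n, S; ℝ⟯) (k : Fin (N + 1)) (a b : C^∞⟮𝓡 n, S; ℝ⟯),
    toMultilinearMap (Function.update F k (a * b)) =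
      a * toMultilinearMap (Function.update F k b) + b * toMultilinearMap (Function.update F k a)

open Classical in
/-- A global smooth function which agrees with `h` near `p` (and `0` if there is none). On a
Hausdorff manifold there is one whenever `h` is smooth on a neighbourhood of `p`. -/
def globalize (p : S) (h : S → ℝ) : C^∞⟮𝓡 n, S; ℝ⟯ :=
  if H : ∃ F : C^∞⟮𝓡 n, S; ℝ⟯, (F : S → ℝ) =ᶠ[𝓝 p] h then H.choose else 0

/-- The value at `p` of the bracket of functions that are smooth near `p`. A bracket which is a
derivation in each argument is local, so that the value at `p` depends only on the germs at `p`. -/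
def Bracket.at (br : Bracket n N S) (p : S) (h : Fin (N + 1) → S → ℝ) : ℝ :=
  br.toMultilinearMap (fun k => globalize p (h k)) p

/-- Brackets are local: an argument that vanishes near `p` makes the bracket vanish at `p`. -/
theorem Bracket.eq_zero_of_eventuallyEq_zero [T2Space S] [IsManifold (𝓡 n) ∞ S]
    (br : Bracket n N S) (p : S) (F : Fin (N + 1) → C^∞⟮𝓡 n, S; ℝ⟯) (k : Fin (N + 1))
    (a : C^∞⟮𝓡 n, S; ℝ⟯) (h : (a : S → ℝ) =ᶠ[𝓝 p] 0) :
    br.toMultilinearMap (Function.update F k a) p = 0 := by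
  obtain ⟨s, hs, hs'⟩ := Filter.eventually_iff_exists_mem.1 h
  obtain ⟨χ, hχ⟩ := (SmoothBumpFunction.nhds_basis_tsupport (I := 𝓡 n) p).mem_iff.1 hs
  obtain ⟨b, hb⟩ : ∃ b : C^∞⟮𝓡 n, S; ℝ⟯, ∀ x, b x = 1 - χ x :=
    ⟨⟨fun x => 1 - χ x, contMDiff_const.sub χ.contMDiff⟩, fun _ => rfl⟩
  have e : a = b * a := by
    ext x
    rw [ContMDiffMap.coe_mul, Pi.mul_apply, hb]
    by_cases hx : x ∈ s
    · simp [hs' x hx]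
    · have : χ x = 0 := image_eq_zero_of_notMem_tsupport (fun h => hx (hχ.2 h))
      simp [this]
  rw [e, br.leibniz]
  have h1 : a p = 0 := h.self_of_nhds
  have h2 : b p = 0 := by simp [hb]
  simp [h1, h2]

/-- On global smooth functions, `Bracket.at` is the bracket itself. -/
theorem Bracket.at_coe [T2Space S] [IsManifold (𝓡 n) ∞ S] (br : Bracket n N S) (p : S)
    (F : Fin (N + 1) → C^∞⟮𝓡 n, S; ℝ⟯) :
    br.at p (fun k => (F k : S → ℝ)) = br.toMultilinearMap F p := by
  have hG : ∀ k, (globalize (n := n) p (F k : S → ℝ) : S → ℝ) =ᶠ[𝓝 p] F k := by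
    intro k
    have H : ∃ G : C^∞⟮𝓡 n, S; ℝ⟯, (G : S → ℝ) =ᶠ[𝓝 p] F k := ⟨F k, Filter.EventuallyEq.rfl⟩
    simp only [globalize, dif_pos H]
    exact H.choose_spec
  have key : ∀ s : Finset (Fin (N + 1)),
      br.toMultilinearMap (s.piecewise (fun k => globalize p (F k : S → ℝ)) F) p =
        br.toMultilinearMap F p := by
    intro s
    induction s using Finset.induction_on with
    | empty => simp
    | insert k s hk ih =>
      rw [Finset.piecewise_insert, ← ih]
      set P := s.piecewise (fun k => globalize (n := n) p (F k : S → ℝ)) F with hP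
      have hPk : P k = F k := by simp [hP, hk]
      have h0 := br.eq_zero_of_eventuallyEq_zero p P k (globalize p (F k : S → ℝ) - F k) (by
        filter_upwards [hG k] with x hx
        simp [ContMDiffMap.coe_sub, hx])
      rw [MultilinearMap.map_update_sub, ← hPk, Function.update_eq_self,
        ContMDiffMap.coe_sub, Pi.sub_apply, sub_eq_zero] at h0
      rw [← hPk]
      exact h0
  simpa [Bracket.at] using key Finset.univ

end Bracket

/-! ### A submanifold with a bracket, in local coordinates of the ambient space

Everything below is a function of the point `p` of `S`; `f : S → M` is the embedding, `φ` is a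
chart of `M`, and components of tensors of `M` along `S` refer to the coordinates of `φ`. -/

section Submanifold

variable {m n N : ℕ} {M : Type*} [TopologicalSpace M] [ChartedSpace (EuclideanSpace ℝ (Fin m)) M]
  {S : Type*} [TopologicalSpace S] [ChartedSpace (EuclideanSpace ℝ (Fin n)) S]

/-- The embedding coordinate functions `x^i`. -/
def embCoord (f : S → M) (φ : OpenPartialHomeomorph M (EuclideanSpace ℝ (Fin m)))
    (i : Fin m) (p : S) : ℝ :=
  φ (f p) i

/-- The partial derivative `∂_a h` with respect to the chart `ψ` of `S`. -/
def chartPd (ψ : OpenPartialHomeomorph S (EuclideanSpace ℝ (Fin n))) (a : Fin n) (h : S → ℝ)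
    (p : S) : ℝ :=
  pd a (fun u => h (ψ.symm u)) (ψ p)

/-- `{h, x^{i_1}, …, x^{i_N}}`. -/
def bracketCoord (br : Bracket n N S) (f : S → M)
    (φ : OpenPartialHomeomorph M (EuclideanSpace ℝ (Fin m))) (h : S → ℝ)
    (I : Fin N → Fin m) (p : S) : ℝ :=
  br.at p (Fin.cons h fun r => embCoord f φ (I r))

/-- `𝒫^{iI} = {x^i, x^I} / √N!`. -/
def PP (br : Bracket n N S) (f : S → M) (φ : OpenPartialHomeomorph M (EuclideanSpace ℝ (Fin m)))
    (i : Fin m) (I : Fin N → Fin m) (p : S) : ℝ :=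
  1 / √(N.factorial : ℝ) * bracketCoord br f φ (embCoord f φ i) I p

/-- `η_{ij}` along `S`. -/
def etaLow (η : BilinField m M) (f : S → M)
    (φ : OpenPartialHomeomorph M (EuclideanSpace ℝ (Fin m))) (i j : Fin m) (p : S) : ℝ :=
  metricComp η φ (φ (f p)) i j

/-- `η^{ij}` along `S`. -/
def etaUp (η : BilinField m M) (f : S → M)
    (φ : OpenPartialHomeomorph M (EuclideanSpace ℝ (Fin m))) (i j : Fin m) (p : S) : ℝ :=
  (metricComp η φ (φ (f p)))⁻¹ i j

/-- `η_{IJ} = η_{i_1 j_1} ⋯ η_{i_N j_N}` along `S`. -/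
def etaMulti (η : BilinField m M) (f : S → M)
    (φ : OpenPartialHomeomorph M (EuclideanSpace ℝ (Fin m))) (I J : Fin N → Fin m) (p : S) : ℝ :=
  ∏ r, etaLow η f φ (I r) (J r) p

/-- The ambient Christoffel symbols along `S`. -/
def gammaBar (η : BilinField m M) (f : S → M)
    (φ : OpenPartialHomeomorph M (EuclideanSpace ℝ (Fin m))) (k i j : Fin m) (p : S) : ℝ :=
  christoffel (metricComp η φ) k i j (φ (f p))

/-- The ambient curvature components `R̄_{ijkl} = η(R̄(∂_k,∂_l)∂_j, ∂_i)` along `S`. -/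
def RBar (η : BilinField m M) (f : S → M)
    (φ : OpenPartialHomeomorph M (EuclideanSpace ℝ (Fin m))) (i j k l : Fin m) (p : S) : ℝ :=
  curvatureLow (metricComp η φ) i j k l (φ (f p))

/-- `g^{ab} (∂_a h) (∂_b h')`, for the induced metric `g`, in the chart `ψ` of `S`. -/
def gradInner (η : BilinField m M) (f : S → M)
    (ψ : OpenPartialHomeomorph S (EuclideanSpace ℝ (Fin n))) (h h' : S → ℝ) (p : S) : ℝ :=
  ∑ a, ∑ b, (metricComp (inducedMetric η f) ψ (ψ p))⁻¹ a b * chartPd ψ a h p * chartPd ψ b h' p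

/-- The compatibility `𝒫^{iI} 𝒫^{jJ} η_{IJ} = ε γ² g^{ab} (∂_a x^i) (∂_b x^j)` of bracket and
metric, on the common domain of the coordinates of `φ` and `ψ`. -/
def IsCompatible (η : BilinField m M) (f : S → M) (br : Bracket n N S) (ε : ℝ) (γ : S → ℝ)
    (φ : OpenPartialHomeomorph M (EuclideanSpace ℝ (Fin m)))
    (ψ : OpenPartialHomeomorph S (EuclideanSpace ℝ (Fin n))) : Prop :=
  ∀ q ∈ ψ.source, f q ∈ φ.source → ∀ i j : Fin m,
    ∑ I : Fin N → Fin m, ∑ J : Fin N → Fin m,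
        PP br f φ i I q * PP br f φ j J q * etaMulti η f φ I J q =
      ε * γ q ^ 2 * gradInner η f ψ (embCoord f φ i) (embCoord f φ j) q

variable (η : BilinField m M) (f : S → M) (br : Bracket n N S) (ε : ℝ) (γ : S → ℝ)
  (φ : OpenPartialHomeomorph M (EuclideanSpace ℝ (Fin m)))

/-- `𝒟^{ij} = ε γ⁻² 𝒫^{iI} 𝒫^{jJ} η_{IJ}`. -/
def DD (i j : Fin m) (p : S) : ℝ :=
  ε / γ p ^ 2 * ∑ I : Fin N → Fin m, ∑ J : Fin N → Fin m,
    PP br f φ i I p * PP br f φ j J p * etaMulti η f φ I J p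

/-- `𝒟^i(h) = ε / (γ² N!) {x^i, x^I} {h, x^J} η_{IJ}`. -/
def DOpUp (i : Fin m) (h : S → ℝ) (p : S) : ℝ :=
  ε / (γ p ^ 2 * (N.factorial : ℝ)) * ∑ I : Fin N → Fin m, ∑ J : Fin N → Fin m,
    bracketCoord br f φ (embCoord f φ i) I p * bracketCoord br f φ h J p * etaMulti η f φ I J p

/-- `𝒟_k(h) = η_{ki} 𝒟^i(h)`. -/
def DOp (k : Fin m) (h : S → ℝ) (p : S) : ℝ :=
  ∑ i, etaLow η f φ k i p * DOpUp η f br ε γ φ i h p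

/-- `𝒟_k^l = η_{ki} 𝒟^{il}`. -/
def DMixed (k l : Fin m) (p : S) : ℝ :=
  ∑ i, etaLow η f φ k i p * DD η f br ε γ φ i l p

/-- `Π^{ij} = η^{ij} - 𝒟^{ij}`. -/
def PiUp (i j : Fin m) (p : S) : ℝ :=
  etaUp η f φ i j p - DD η f br ε γ φ i j p

/-- `Π_{ij} = η_{ij} - 𝒟_{ij}`. -/
def PiLow (i j : Fin m) (p : S) : ℝ :=
  etaLow η f φ i j p - ∑ l, DMixed η f br ε γ φ i l p * etaLow η f φ l j p

/-- `∇̂_k T^{ij} = 𝒟_k(T^{ij}) + 𝒟_k^l (Γ̄^i_{lp} T^{pj} + Γ̄^j_{lp} T^{ip})`, the components of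
the derivative `∇̄_{𝒟(∂_k)} T` of a tensor field `T` along `S`. -/
def nablaHatUp (k : Fin m) (T : Fin m → Fin m → S → ℝ) (i j : Fin m) (p : S) : ℝ :=
  DOp η f br ε γ φ k (T i j) p + ∑ l, DMixed η f br ε γ φ k l p *
    ∑ q, (gammaBar η f φ i l q p * T q j p + gammaBar η f φ j l q p * T i q p)

/-- `∇̂_k T_{ij} = 𝒟_k(T_{ij}) - 𝒟_k^l (Γ̄^p_{li} T_{pj} + Γ̄^p_{lj} T_{ip})`. -/
def nablaHatLow (k : Fin m) (T : Fin m → Fin m → S → ℝ) (i j : Fin m) (p : S) : ℝ :=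
  DOp η f br ε γ φ k (T i j) p - ∑ l, DMixed η f br ε γ φ k l p *
    ∑ q, (gammaBar η f φ q l i p * T q j p + gammaBar η f φ q l j p * T i q p)

/-- `∇̂_k Π^{ij}`. -/
def dPiUp (k i j : Fin m) (p : S) : ℝ :=
  nablaHatUp η f br ε γ φ k (PiUp η f br ε γ φ) i j p

/-- `∇̂_k Π_{ij}`. -/
def dPiLow (k i j : Fin m) (p : S) : ℝ :=
  nablaHatLow η f br ε γ φ k (PiLow η f br ε γ φ) i j p

/-- `∇̂^k Π^{ij} = η^{kl} ∇̂_l Π^{ij}`. -/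
def dUpPiUp (k i j : Fin m) (p : S) : ℝ :=
  ∑ l, etaUp η f φ k l p * dPiUp η f br ε γ φ l i j p

/-- `∇̂^k Π_{ij} = η^{kl} ∇̂_l Π_{ij}`. -/
def dUpPiLow (k i j : Fin m) (p : S) : ℝ :=
  ∑ l, etaUp η f φ k l p * dPiLow η f br ε γ φ l i j p

end Submanifold

end BracketGeometry

end

/-! In charts, write `E` for the Jacobian of `f`, `H` for the matrix of `η`, `g = Eᵀ H E` for that
of the induced metric, and `L = H E g⁻¹`, so that `Lᵀ E = 1`. Only the invertibility of `H` and `g`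
enters, so the signature plays no role.

On the bracket side, freezing all arguments but the first gives a point derivation. By Hadamard's
lemma, `{h, x^I} = ∂_a h {u^a, x^I}` (`bracketCoord_eq_sum`). With `C^{ab} = {u^a, x^I} {u^b, x^J}
η_{IJ}`, compatibility reads `E C Eᵀ = N! ε γ² E g⁻¹ Eᵀ`. Multiplying by `Lᵀ` and `L` removes `E`,
whence `C = N! ε γ² g⁻¹` (`bracket_metric`). Thus a condition on the embedding coordinates alone
controls `𝒟^i(h)` for every `h`: the matrix `𝒟^{ij}` is the tangential projection `E g⁻¹ Eᵀ`, the
operator `𝒟_k` is `L_k^b ∂_b`, and `∇̂_k` is `L_k^b ∇̄_b`.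

On the geometric side, let `K_b` be the second fundamental form, which satisfies `Eᵀ H K_b = 0`.
Because `η` is parallel, `∇̄_b Π = -(K_b g⁻¹ Eᵀ + E g⁻¹ K_bᵀ)` (`nabla_proj`). Contracting with `E`
or `L` leaves one of these two terms, by normality. Along tangent vectors the two products of
derivatives of `Π` become `g^{cd} ⟨K_{cd}, K_{ab}⟩` and `g^{cd} ⟨K_{ca}, K_{bd}⟩`, which are exactly
the quadratic terms of the contracted Gauss equation (`gauss_equation`, `ricciComp_eq`). For the
scalar curvature one contracts once more with `𝒟^{ij}`. In the quadratic terms this may be replaced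
by `η^{ij}`, since the derivative index of `∇̂` is tangential (`scalar_eq`).

The bridge between the two sides is `dPiUp_eq` and `dPiLow_eq`. -/

noncomputable section

namespace BracketGeometry

/-! ### Partial derivatives -/

section PartialDerivatives

variable {d : ℕ} {F G : EuclideanSpace ℝ (Fin d) → ℝ} {U : Set (EuclideanSpace ℝ (Fin d))}
  {u : EuclideanSpace ℝ (Fin d)}

theorem pd_congr (a : Fin d) (h : F =ᶠ[𝓝 u] G) : pd a F u = pd a G u := by
  simp only [pd, h.fderiv_eq]

theorem pd_add (a : Fin d) (hF : DifferentiableAt ℝ F u) (hG : DifferentiableAt ℝ G u) :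
    pd a (fun v => F v + G v) u = pd a F u + pd a G u := by
  simp [pd, fderiv_fun_add hF hG]

theorem pd_sub (a : Fin d) (hF : DifferentiableAt ℝ F u) (hG : DifferentiableAt ℝ G u) :
    pd a (fun v => F v - G v) u = pd a F u - pd a G u := by
  simp [pd, fderiv_fun_sub hF hG]

theorem pd_mul (a : Fin d) (hF : DifferentiableAt ℝ F u) (hG : DifferentiableAt ℝ G u) :
    pd a (fun v => F v * G v) u = pd a F u * G u + F u * pd a G u := by
  simp [pd, fderiv_fun_mul hF hG]; ring

theorem pd_const (a : Fin d) (c : ℝ) : pd a (fun _ => c) u = 0 := by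
  simp [pd]

theorem pd_sum {ι : Type*} (s : Finset ι) (a : Fin d) {A : ι → EuclideanSpace ℝ (Fin d) → ℝ}
    (h : ∀ i ∈ s, DifferentiableAt ℝ (A i) u) :
    pd a (fun v => ∑ i ∈ s, A i v) u = ∑ i ∈ s, pd a (A i) u := by
  simp [pd, fderiv_fun_sum h]

theorem _root_.ContDiffOn.pd (hU : IsOpen U) (a : Fin d) (hF : ContDiffOn ℝ ∞ F U) :
    ContDiffOn ℝ ∞ (pd a F) U :=
  (hF.fderiv_of_isOpen hU (by simp)).clm_apply contDiffOn_const

theorem differentiableAt_of_contDiffOn (hU : IsOpen U) (hu : u ∈ U) (hF : ContDiffOn ℝ ∞ F U) :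
    DifferentiableAt ℝ F u :=
  (hF.contDiffAt (hU.mem_nhds hu)).differentiableAt (by simp)

theorem pd_comm (hU : IsOpen U) (hu : u ∈ U) (hF : ContDiffOn ℝ ∞ F U) (a b : Fin d) :
    pd a (pd b F) u = pd b (pd a F) u := by
  have h2 : ContDiffAt ℝ ∞ F u := hF.contDiffAt (hU.mem_nhds hu)
  have hd : DifferentiableAt ℝ (fderiv ℝ F) u :=
    (h2.fderiv_right (m := ∞) (by simp)).differentiableAt (by simp)
  have key : ∀ a b : Fin d, pd a (pd b F) u =
      fderiv ℝ (fderiv ℝ F) u (EuclideanSpace.single a 1) (EuclideanSpace.single b 1) := by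
    intro a b
    have : pd b F = fun v => fderiv ℝ F v (EuclideanSpace.single b 1) := rfl
    rw [this, pd, fderiv_clm_apply hd (differentiableAt_const _)]
    simp
  rw [key, key]
  exact (h2.isSymmSndFDerivAt (by simp only [minSmoothness_of_isRCLikeNormedField]; exact WithTop.coe_le_coe.2 le_top)) _ _

theorem fderiv_apply_apply {m : ℕ}
    {Φ : EuclideanSpace ℝ (Fin d) → EuclideanSpace ℝ (Fin m)} (hΦ : DifferentiableAt ℝ Φ u)
    (w : EuclideanSpace ℝ (Fin d)) (i : Fin m) :
    fderiv ℝ Φ u w i = fderiv ℝ (fun v => Φ v i) u w := by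
  have h3 : fderiv ℝ (fun v => Φ v i) u = (EuclideanSpace.proj (𝕜 := ℝ) i).comp (fderiv ℝ Φ u) :=
    ((EuclideanSpace.proj (𝕜 := ℝ) i).hasFDerivAt.comp u hΦ.hasFDerivAt).fderiv
  simp [h3]

theorem eq_sum_single (w : EuclideanSpace ℝ (Fin d)) :
    w = ∑ i, w i • (EuclideanSpace.single i (1 : ℝ)) := by
  ext j; simp [Finset.sum_apply, Pi.single_apply]

/-- The chain rule in coordinates. -/
theorem pd_comp {m : ℕ} {h : EuclideanSpace ℝ (Fin m) → ℝ}
    {Φ : EuclideanSpace ℝ (Fin d) → EuclideanSpace ℝ (Fin m)} (a : Fin d)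
    (hh : DifferentiableAt ℝ h (Φ u)) (hΦ : DifferentiableAt ℝ Φ u) :
    pd a (fun v => h (Φ v)) u = ∑ i, pd i h (Φ u) * pd a (fun v => Φ v i) u := by
  have e1 : fderiv ℝ (fun v => h (Φ v)) u = (fderiv ℝ h (Φ u)).comp (fderiv ℝ Φ u) :=
    fderiv_comp u hh hΦ
  simp only [pd, e1, ContinuousLinearMap.comp_apply, ← fderiv_apply_apply hΦ]
  conv_lhs => rw [eq_sum_single (fderiv ℝ Φ u (EuclideanSpace.single a 1))]
  simp [map_sum, mul_comm]

end PartialDerivatives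

/-! ### Matrix-valued functions -/

section MatrixCalculus

open Matrix

variable {d p q r : ℕ} {U : Set (EuclideanSpace ℝ (Fin d))} {u : EuclideanSpace ℝ (Fin d)}

/-- The entrywise partial derivative of a matrix-valued function. -/
def mpd (a : Fin d) (A : EuclideanSpace ℝ (Fin d) → Matrix (Fin p) (Fin q) ℝ)
    (u : EuclideanSpace ℝ (Fin d)) : Matrix (Fin p) (Fin q) ℝ :=
  Matrix.of fun i j => pd a (fun v => A v i j) u

theorem mpd_apply (a : Fin d) (A : EuclideanSpace ℝ (Fin d) → Matrix (Fin p) (Fin q) ℝ)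
    (i : Fin p) (j : Fin q) : mpd a A u i j = pd a (fun v => A v i j) u := rfl

/-- Matrix-valued functions whose entries are smooth on `U`. -/
def SmoothMat (A : EuclideanSpace ℝ (Fin d) → Matrix (Fin p) (Fin q) ℝ)
    (U : Set (EuclideanSpace ℝ (Fin d))) : Prop :=
  ∀ i j, ContDiffOn ℝ ∞ (fun v => A v i j) U

variable {A A' : EuclideanSpace ℝ (Fin d) → Matrix (Fin p) (Fin q) ℝ}
  {B : EuclideanSpace ℝ (Fin d) → Matrix (Fin q) (Fin r) ℝ}

theorem mpd_congr (a : Fin d) (h : A =ᶠ[𝓝 u] A') : mpd a A u = mpd a A' u := by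
  ext i j
  exact pd_congr a (h.mono fun v hv => by simp only [hv])

theorem SmoothMat.congr (hA : SmoothMat A U) (h : ∀ v ∈ U, A' v = A v) : SmoothMat A' U :=
  fun i j => (hA i j).congr fun v hv => by rw [h v hv]

theorem SmoothMat.differentiableAt (hA : SmoothMat A U) (hU : IsOpen U) (hu : u ∈ U)
    (i : Fin p) (j : Fin q) : DifferentiableAt ℝ (fun v => A v i j) u :=
  differentiableAt_of_contDiffOn hU hu (hA i j)

theorem SmoothMat.mul (hA : SmoothMat A U) (hB : SmoothMat B U) :
    SmoothMat (fun v => A v * B v) U := by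
  intro i j
  simp only [Matrix.mul_apply]
  exact ContDiffOn.sum fun k _ => (hA i k).mul (hB k j)

theorem SmoothMat.transpose (hA : SmoothMat A U) : SmoothMat (fun v => (A v)ᵀ) U :=
  fun i j => hA j i

theorem SmoothMat.add (hA : SmoothMat A U) (hA' : SmoothMat A' U) :
    SmoothMat (fun v => A v + A' v) U :=
  fun i j => (hA i j).add (hA' i j)

theorem SmoothMat.sub (hA : SmoothMat A U) (hA' : SmoothMat A' U) :
    SmoothMat (fun v => A v - A' v) U :=
  fun i j => (hA i j).sub (hA' i j)

theorem SmoothMat.mpd (hA : SmoothMat A U) (hU : IsOpen U) (a : Fin d) :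
    SmoothMat (mpd a A) U :=
  fun i j => (hA i j).pd hU a

theorem SmoothMat.det {A : EuclideanSpace ℝ (Fin d) → Matrix (Fin p) (Fin p) ℝ}
    (hA : SmoothMat A U) : ContDiffOn ℝ ∞ (fun v => (A v).det) U := by
  simp only [Matrix.det_apply']
  exact ContDiffOn.sum fun σ _ => contDiffOn_const.mul (contDiffOn_prod fun i _ => hA _ _)

/-- Cramer's rule: each entry of the inverse is a determinant with one row replaced by a basis
vector, divided by a nonvanishing smooth determinant. -/
theorem SmoothMat.inv {A : EuclideanSpace ℝ (Fin d) → Matrix (Fin p) (Fin p) ℝ}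
    (hA : SmoothMat A U) (h : ∀ v ∈ U, (A v).det ≠ 0) : SmoothMat (fun v => (A v)⁻¹) U := by
  intro i j
  simp only [Matrix.inv_def, Ring.inverse_eq_inv', Matrix.smul_apply, smul_eq_mul,
    Matrix.adjugate_apply]
  refine (hA.det.inv h).mul ?_
  refine SmoothMat.det (A := fun v => (A v).updateRow j (Pi.single i 1)) fun k l => ?_
  by_cases hk : k = j
  · subst hk; simpa using contDiffOn_const
  · simpa [Matrix.updateRow_ne hk] using hA k l

theorem mpd_mul (hU : IsOpen U) (hu : u ∈ U) (hA : SmoothMat A U) (hB : SmoothMat B U)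
    (a : Fin d) : mpd a (fun v => A v * B v) u = mpd a A u * B u + A u * mpd a B u := by
  ext i j
  simp only [mpd_apply, Matrix.mul_apply, Matrix.add_apply]
  rw [pd_sum (A := fun k v => A v i k * B v k j) _ _ fun k _ =>
    (hA.differentiableAt hU hu i k).mul (hB.differentiableAt hU hu k j), ← Finset.sum_add_distrib]
  exact Finset.sum_congr rfl fun k _ =>
    pd_mul a (hA.differentiableAt hU hu i k) (hB.differentiableAt hU hu k j)

theorem mpd_add (hU : IsOpen U) (hu : u ∈ U) (hA : SmoothMat A U) (hA' : SmoothMat A' U)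
    (a : Fin d) : mpd a (fun v => A v + A' v) u = mpd a A u + mpd a A' u := by
  ext i j
  exact pd_add a (hA.differentiableAt hU hu i j) (hA'.differentiableAt hU hu i j)

theorem mpd_sub (hU : IsOpen U) (hu : u ∈ U) (hA : SmoothMat A U) (hA' : SmoothMat A' U)
    (a : Fin d) : mpd a (fun v => A v - A' v) u = mpd a A u - mpd a A' u := by
  ext i j
  exact pd_sub a (hA.differentiableAt hU hu i j) (hA'.differentiableAt hU hu i j)

theorem mpd_transpose (a : Fin d) : mpd a (fun v => (A v)ᵀ) u = (mpd a A u)ᵀ := rfl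

theorem mpd_const (a : Fin d) (C : Matrix (Fin p) (Fin q) ℝ) : mpd a (fun _ => C) u = 0 := by
  ext i j; exact pd_const a _

theorem mpd_comm (hU : IsOpen U) (hu : u ∈ U) (hA : SmoothMat A U) (a b : Fin d) :
    mpd a (mpd b A) u = mpd b (mpd a A) u := by
  ext i j
  exact pd_comm hU hu (hA i j) a b

/-- Obtained by differentiating `A A⁻¹ = 1`. -/
theorem mpd_inv {A : EuclideanSpace ℝ (Fin d) → Matrix (Fin p) (Fin p) ℝ} (hU : IsOpen U)
    (hu : u ∈ U) (hA : SmoothMat A U) (h : ∀ v ∈ U, (A v).det ≠ 0) (a : Fin d) :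
    mpd a (fun v => (A v)⁻¹) u = -((A u)⁻¹ * mpd a A u * (A u)⁻¹) := by
  have hi : ∀ v ∈ U, A v * (A v)⁻¹ = 1 := fun v hv =>
    Matrix.mul_nonsing_inv _ (h v hv).isUnit
  have h1 := mpd_mul hU hu hA (hA.inv h) a
  rw [mpd_congr (A' := fun _ => 1) a (Filter.eventually_of_mem (hU.mem_nhds hu) hi),
    mpd_const] at h1
  have h2 := congrArg (fun X => (A u)⁻¹ * X) h1
  simp only [Matrix.mul_zero, Matrix.mul_add, ← Matrix.mul_assoc,
    Matrix.nonsing_inv_mul _ (h u hu).isUnit, Matrix.one_mul] at h2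
  exact eq_neg_of_add_eq_zero_right h2.symm

end MatrixCalculus

/-! ### Christoffel symbols and curvature as matrices -/

section Christoffel

open Matrix

variable {d : ℕ} {h : EuclideanSpace ℝ (Fin d) → Matrix (Fin d) (Fin d) ℝ}
  {U : Set (EuclideanSpace ℝ (Fin d))} {u : EuclideanSpace ℝ (Fin d)}

/-- The connection matrix `(Γ^i_{cj})_{ij}`. -/
def chrMat (h : EuclideanSpace ℝ (Fin d) → Matrix (Fin d) (Fin d) ℝ) (c : Fin d)
    (u : EuclideanSpace ℝ (Fin d)) : Matrix (Fin d) (Fin d) ℝ :=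
  Matrix.of fun i j => christoffel h i c j u

/-- The curvature matrix `(R^i_{jkl})_{ij}`. -/
def curvMat (h : EuclideanSpace ℝ (Fin d) → Matrix (Fin d) (Fin d) ℝ) (k l : Fin d)
    (u : EuclideanSpace ℝ (Fin d)) : Matrix (Fin d) (Fin d) ℝ :=
  Matrix.of fun i j => curvatureUp h i j k l u

/-- The curvature `dΓ + Γ ∧ Γ` of a matrix-valued connection form. In this form the Gauss equation
becomes noncommutative algebra without indices. -/
theorem curvMat_eq (k l : Fin d) : curvMat h k l u =
    mpd k (chrMat h l) u - mpd l (chrMat h k) u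
      + (chrMat h k u * chrMat h l u - chrMat h l u * chrMat h k u) := by
  ext i j
  simp [curvMat, curvatureUp, mpd, chrMat, Matrix.mul_apply, Finset.sum_sub_distrib]

theorem christoffel_symm (hs : ∀ v, (h v)ᵀ = h v) (k i j : Fin d) :
    christoffel h k i j u = christoffel h k j i u := by
  have e : (fun v => h v i j) = fun v => h v j i :=
    funext fun v => (congrFun (congrFun (hs v) j) i)
  simp only [christoffel, e]
  congr 1
  exact Finset.sum_congr rfl fun l _ => by ring

/-- Lowering the upper index cancels the inverse metric and leaves the Christoffel symbols of the
first kind. -/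
theorem mul_chrMat_apply (hd : (h u).det ≠ 0) (c l j : Fin d) :
    (h u * chrMat h c u) l j = (1 / 2 : ℝ) * (pd c (fun v => h v j l) u
      + pd j (fun v => h v c l) u - pd l (fun v => h v c j) u) := by
  set T : Fin d → ℝ := fun l => pd c (fun v => h v j l) u
      + pd j (fun v => h v c l) u - pd l (fun v => h v c j) u
  have h1 : (h u * chrMat h c u) l j = (1 / 2 : ℝ) * (h u *ᵥ ((h u)⁻¹ *ᵥ T)) l := by
    simp only [Matrix.mul_apply, chrMat, christoffel, Matrix.of_apply, Matrix.mulVec, dotProduct,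
      Finset.mul_sum, T]
    exact Finset.sum_congr rfl fun k _ => Finset.sum_congr rfl fun s _ => by ring
  rw [h1, Matrix.mulVec_mulVec, Matrix.mul_nonsing_inv _ hd.isUnit, Matrix.one_mulVec]

/-- Metric compatibility of the Levi-Civita connection: in the sum of two symbols of the first kind
the other derivatives cancel. -/
theorem mpd_metric (hs : ∀ v, (h v)ᵀ = h v) (hd : (h u).det ≠ 0) (c : Fin d) :
    mpd c h u = (chrMat h c u)ᵀ * h u + h u * chrMat h c u := by
  have e : ∀ i j, (fun v => h v i j) = fun v => h v j i := fun i j =>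
    funext fun v => (congrFun (congrFun (hs v) j) i)
  have e1 : (chrMat h c u)ᵀ * h u = (h u * chrMat h c u)ᵀ := by
    rw [Matrix.transpose_mul, hs]
  ext i j
  rw [e1, Matrix.add_apply, Matrix.transpose_apply, mul_chrMat_apply hd, mul_chrMat_apply hd,
    mpd_apply, e j i, e c i, e c j]
  ring

theorem SmoothMat.chrMat (hU : IsOpen U) (hh : SmoothMat h U) (hd : ∀ v ∈ U, (h v).det ≠ 0)
    (c : Fin d) : SmoothMat (chrMat h c) U := by
  intro i j
  refine ContDiffOn.mul contDiffOn_const (ContDiffOn.sum fun l _ => ?_)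
  exact (hh.inv hd i l).mul ((((hh j l).pd hU c).add ((hh c l).pd hU j)).sub ((hh c j).pd hU l))

end Christoffel

/-! ### Isometric immersions in coordinates -/

section Immersion

open Matrix

variable {m n : ℕ}

/-- The Jacobian matrix. -/
def jac (F : EuclideanSpace ℝ (Fin n) → EuclideanSpace ℝ (Fin m)) (v : EuclideanSpace ℝ (Fin n)) :
    Matrix (Fin m) (Fin n) ℝ :=
  Matrix.of fun i a => pd a (fun w => F w i) v

/-- The pulled back connection matrix `Γ̄^i_{jk} ∂_c F^j`. -/
def connMat (H : EuclideanSpace ℝ (Fin m) → Matrix (Fin m) (Fin m) ℝ)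
    (F : EuclideanSpace ℝ (Fin n) → EuclideanSpace ℝ (Fin m)) (c : Fin n)
    (v : EuclideanSpace ℝ (Fin n)) : Matrix (Fin m) (Fin m) ℝ :=
  ∑ j, jac F v j c • chrMat H j (F v)

/-- The second fundamental form `∇̄_c ∂_b - Γ^a_{cb} ∂_a`. -/
def sff (H : EuclideanSpace ℝ (Fin m) → Matrix (Fin m) (Fin m) ℝ)
    (G : EuclideanSpace ℝ (Fin n) → Matrix (Fin n) (Fin n) ℝ)
    (F : EuclideanSpace ℝ (Fin n) → EuclideanSpace ℝ (Fin m)) (c : Fin n)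
    (v : EuclideanSpace ℝ (Fin n)) : Matrix (Fin m) (Fin n) ℝ :=
  mpd c (jac F) v + connMat H F c v * jac F v - jac F v * chrMat G c v

/-- Smooth maps `F` from an open set `U` to an open set `W` which are isometric for the
nondegenerate metrics `G` and `H`. -/
structure IsIsometricOn (U : Set (EuclideanSpace ℝ (Fin n))) (W : Set (EuclideanSpace ℝ (Fin m)))
    (F : EuclideanSpace ℝ (Fin n) → EuclideanSpace ℝ (Fin m))
    (G : EuclideanSpace ℝ (Fin n) → Matrix (Fin n) (Fin n) ℝ)
    (H : EuclideanSpace ℝ (Fin m) → Matrix (Fin m) (Fin m) ℝ) : Prop where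
  isOpen_source : IsOpen U
  isOpen_target : IsOpen W
  contDiffOn : ContDiffOn ℝ ∞ F U
  mapsTo : Set.MapsTo F U W
  smooth : SmoothMat H W
  symm_target : ∀ v, (H v)ᵀ = H v
  symm_source : ∀ v, (G v)ᵀ = G v
  det_target : ∀ v ∈ W, (H v).det ≠ 0
  det_source : ∀ v ∈ U, (G v).det ≠ 0
  metric_eq : ∀ v ∈ U, G v = (jac F v)ᵀ * (H (F v) * jac F v)

variable {U : Set (EuclideanSpace ℝ (Fin n))} {W : Set (EuclideanSpace ℝ (Fin m))}
  {F : EuclideanSpace ℝ (Fin n) → EuclideanSpace ℝ (Fin m)}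
  {G : EuclideanSpace ℝ (Fin n) → Matrix (Fin n) (Fin n) ℝ}
  {H : EuclideanSpace ℝ (Fin m) → Matrix (Fin m) (Fin m) ℝ}
  {u : EuclideanSpace ℝ (Fin n)}

namespace IsIsometricOn

theorem contDiffOn_apply (hi : IsIsometricOn U W F G H) (i : Fin m) :
    ContDiffOn ℝ ∞ (fun v => F v i) U :=
  (EuclideanSpace.proj (𝕜 := ℝ) i).contDiff.comp_contDiffOn hi.contDiffOn

theorem smooth_jac (hi : IsIsometricOn U W F G H) : SmoothMat (jac F) U :=
  fun i a => (hi.contDiffOn_apply i).pd hi.isOpen_source a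

theorem smooth_comp (hi : IsIsometricOn U W F G H) {p q : ℕ}
    {A : EuclideanSpace ℝ (Fin m) → Matrix (Fin p) (Fin q) ℝ} (hA : SmoothMat A W) :
    SmoothMat (fun v => A (F v)) U :=
  fun i j => (hA i j).comp hi.contDiffOn hi.mapsTo

/-- Smoothness of the induced metric need not be assumed: it is inherited from `H` and `F` through
`metric_eq`. -/
theorem smooth_source (hi : IsIsometricOn U W F G H) : SmoothMat G U :=
  (hi.smooth_jac.transpose.mul ((hi.smooth_comp hi.smooth).mul hi.smooth_jac)).congr hi.metric_eq

theorem smooth_chrMat_target (hi : IsIsometricOn U W F G H) (j : Fin m) :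
    SmoothMat (chrMat H j) W :=
  hi.smooth.chrMat hi.isOpen_target hi.det_target j

theorem smooth_chrMat_source (hi : IsIsometricOn U W F G H) (c : Fin n) :
    SmoothMat (chrMat G c) U :=
  hi.smooth_source.chrMat hi.isOpen_source hi.det_source c

theorem smooth_connMat (hi : IsIsometricOn U W F G H) (c : Fin n) :
    SmoothMat (connMat H F c) U := by
  intro i k
  simp only [connMat, Matrix.sum_apply, Matrix.smul_apply, smul_eq_mul]
  exact ContDiffOn.sum fun j _ => (hi.smooth_jac j c).mul
    (hi.smooth_comp (hi.smooth_chrMat_target j) i k)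

theorem smooth_sff (hi : IsIsometricOn U W F G H) (c : Fin n) : SmoothMat (sff H G F c) U :=
  ((hi.smooth_jac.mpd hi.isOpen_source c).add ((hi.smooth_connMat c).mul hi.smooth_jac)).sub
    (hi.smooth_jac.mul (hi.smooth_chrMat_source c))

theorem mpd_comp (hi : IsIsometricOn U W F G H) (hu : u ∈ U) {p q : ℕ}
    {A : EuclideanSpace ℝ (Fin m) → Matrix (Fin p) (Fin q) ℝ} (hA : SmoothMat A W) (c : Fin n) :
    mpd c (fun v => A (F v)) u = ∑ l, jac F u l c • mpd l A (F u) := by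
  ext i j
  rw [mpd_apply, pd_comp (h := fun w => A w i j) c
    (hA.differentiableAt hi.isOpen_target (hi.mapsTo hu) i j)
    ((hi.contDiffOn.contDiffAt (hi.isOpen_source.mem_nhds hu)).differentiableAt (by simp)),
    Matrix.sum_apply]
  exact Finset.sum_congr rfl fun l _ => mul_comm _ _

/-- The pulled back connection is compatible with the metric along the map: the chain rule applied
to `mpd_metric`. -/
theorem mpd_metric_comp (hi : IsIsometricOn U W F G H) (hu : u ∈ U) (c : Fin n) :
    mpd c (fun v => H (F v)) u =
      (connMat H F c u)ᵀ * H (F u) + H (F u) * connMat H F c u := by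
  rw [hi.mpd_comp hu hi.smooth, connMat, Matrix.transpose_sum, Matrix.sum_mul, Matrix.mul_sum,
    ← Finset.sum_add_distrib]
  refine Finset.sum_congr rfl fun l _ => ?_
  rw [mpd_metric hi.symm_target (hi.det_target _ (hi.mapsTo hu)), smul_add, Matrix.transpose_smul,
    Matrix.smul_mul, Matrix.mul_smul]

/-- Second derivatives of `F` commute and the ambient Christoffel symbols are symmetric, so `∇̄_c
∂_b` is symmetric in `b` and `c`. -/
theorem torsionFree (hi : IsIsometricOn U W F G H) (hu : u ∈ U) (b c : Fin n) (i : Fin m) :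
    (mpd c (jac F) u + connMat H F c u * jac F u) i b =
      (mpd b (jac F) u + connMat H F b u * jac F u) i c := by
  have h1 : mpd c (jac F) u i b = mpd b (jac F) u i c :=
    pd_comm hi.isOpen_source hu (hi.contDiffOn_apply i) c b
  have h2 : (connMat H F c u * jac F u) i b = (connMat H F b u * jac F u) i c := by
    simp only [Matrix.mul_apply, connMat, Matrix.sum_apply, Matrix.smul_apply, smul_eq_mul,
      Finset.sum_mul, chrMat, Matrix.of_apply]
    rw [Finset.sum_comm]
    refine Finset.sum_congr rfl fun k _ => Finset.sum_congr rfl fun j _ => ?_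
    rw [christoffel_symm hi.symm_target i k j]
    ring
  rw [Matrix.add_apply, Matrix.add_apply, h1, h2]

/-- Differentiating `G = Eᵀ H E` with `H` parallel: the derivative of `H` supplies the connection
terms that complete `∂_c E` to `∇̄_c E`. -/
theorem mpd_source (hi : IsIsometricOn U W F G H) (hu : u ∈ U) (c : Fin n) :
    mpd c G u = (mpd c (jac F) u + connMat H F c u * jac F u)ᵀ * (H (F u) * jac F u)
      + (jac F u)ᵀ * (H (F u) * (mpd c (jac F) u + connMat H F c u * jac F u)) := by
  have hO := hi.isOpen_source
  rw [mpd_congr c (Filter.eventually_of_mem (hO.mem_nhds hu) hi.metric_eq),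
    mpd_mul hO hu hi.smooth_jac.transpose ((hi.smooth_comp hi.smooth).mul hi.smooth_jac),
    mpd_mul hO hu (hi.smooth_comp hi.smooth) hi.smooth_jac, hi.mpd_metric_comp hu, mpd_transpose]
  simp only [Matrix.transpose_add, Matrix.transpose_mul, Matrix.mul_add, Matrix.add_mul,
    Matrix.mul_assoc]
  abel

/-- The Gauss formula: the tangential part of `∇̄_c ∂_b` is `∇_c ∂_b`. -/
theorem gauss_formula (hi : IsIsometricOn U W F G H) (hu : u ∈ U) (c : Fin n) :
    (jac F u)ᵀ * (H (F u) * (mpd c (jac F) u + connMat H F c u * jac F u)) =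
      G u * chrMat G c u := by
  -- Koszul's argument. Here `T c a b` is `⟨∂_a, ∇̄_c ∂_b⟩`, symmetric in `b` and `c`, and `∂_c
  -- G_{ab} = T c b a + T c a b`. The alternating sum of three such derivatives isolates `T c a b`.
  set T : Fin n → Matrix (Fin n) (Fin n) ℝ := fun c =>
    (jac F u)ᵀ * (H (F u) * (mpd c (jac F) u + connMat H F c u * jac F u)) with hT
  have hsymm : ∀ a b c, T c a b = T b a c := by
    intro a b c
    simp only [hT, ← Matrix.mul_assoc]
    rw [Matrix.mul_apply, Matrix.mul_apply]
    exact Finset.sum_congr rfl fun i _ => by rw [hi.torsionFree hu b c i]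
  have hG : ∀ a b c, pd c (fun v => G v a b) u = T c b a + T c a b := by
    intro a b c
    have h1 : (mpd c (jac F) u + connMat H F c u * jac F u)ᵀ * (H (F u) * jac F u) = (T c)ᵀ := by
      simp only [hT, Matrix.transpose_mul, Matrix.transpose_transpose, hi.symm_target,
        Matrix.mul_assoc]
    have h2 := congrFun (congrFun (hi.mpd_source hu c) a) b
    rw [h1] at h2
    exact h2
  ext a b
  rw [mul_chrMat_apply (hi.det_source u hu), hG, hG, hG]
  change T c a b = _
  linarith [hsymm a b c, hsymm b a c, hsymm c a b]

/-- The second fundamental form is normal. -/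
theorem normal_sff (hi : IsIsometricOn U W F G H) (hu : u ∈ U) (c : Fin n) :
    (jac F u)ᵀ * (H (F u) * sff H G F c u) = 0 := by
  rw [sff, Matrix.mul_sub, Matrix.mul_sub, hi.gauss_formula hu, hi.metric_eq u hu]
  simp only [Matrix.mul_assoc, sub_self]

/-- The structure equation `∂_c E = E Γ_c + K_c - A_c E`, with `A` the pulled back connection. It
eliminates derivatives of the frame in what follows. -/
theorem mpd_jac (c : Fin n) : mpd c (jac F) u =
    jac F u * chrMat G c u + sff H G F c u - connMat H F c u * jac F u := by
  rw [sff]; abel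

/-- The first sum contains second derivatives of `F`, is symmetric in `c` and `d`, and so drops out
of the curvature. -/
theorem mpd_connMat (hi : IsIsometricOn U W F G H) (hu : u ∈ U) (c d : Fin n) :
    mpd c (connMat H F d) u = (∑ j, mpd c (jac F) u j d • chrMat H j (F u))
      + ∑ j, ∑ l, (jac F u l c * jac F u j d) • mpd l (chrMat H j) (F u) := by
  have hO := hi.isOpen_source
  ext i k
  have hd : ∀ j ∈ (Finset.univ : Finset (Fin m)),
      DifferentiableAt ℝ (fun v => jac F v j d * chrMat H j (F v) i k) u := fun j _ =>
    (hi.smooth_jac.differentiableAt hO hu j d).mul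
      ((hi.smooth_comp (hi.smooth_chrMat_target j)).differentiableAt hO hu i k)
  simp only [mpd_apply, connMat, Matrix.sum_apply, Matrix.smul_apply, smul_eq_mul,
    Matrix.add_apply]
  rw [pd_sum _ _ hd, ← Finset.sum_add_distrib]
  refine Finset.sum_congr rfl fun j _ => ?_
  rw [pd_mul c (hi.smooth_jac.differentiableAt hO hu j d)
    ((hi.smooth_comp (hi.smooth_chrMat_target j)).differentiableAt hO hu i k)]
  have h1 := congrFun (congrFun (hi.mpd_comp hu (hi.smooth_chrMat_target j) c) i) k
  rw [mpd_apply] at h1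
  rw [h1]
  simp only [Matrix.sum_apply, Matrix.smul_apply, smul_eq_mul, Finset.mul_sum, mpd_apply]
  congr 1
  exact Finset.sum_congr rfl fun l _ => by ring

/-- The curvature of the pulled back connection is the pulled back curvature. -/
theorem curvature_connMat (hi : IsIsometricOn U W F G H) (hu : u ∈ U) (c d : Fin n) :
    mpd c (connMat H F d) u - mpd d (connMat H F c) u
      + (connMat H F c u * connMat H F d u - connMat H F d u * connMat H F c u) =
    ∑ l, ∑ j, (jac F u l c * jac F u j d) • curvMat H l j (F u) := by
  have hsymm : ∀ j, mpd c (jac F) u j d = mpd d (jac F) u j c := fun j =>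
    pd_comm hi.isOpen_source hu (hi.contDiffOn_apply j) c d
  have h1 : connMat H F c u * connMat H F d u =
      ∑ l, ∑ j, (jac F u l c * jac F u j d) • (chrMat H l (F u) * chrMat H j (F u)) := by
    simp only [connMat, Finset.sum_mul_sum, smul_mul_smul_comm]
  have h2 : connMat H F d u * connMat H F c u =
      ∑ l, ∑ j, (jac F u l c * jac F u j d) • (chrMat H j (F u) * chrMat H l (F u)) := by
    rw [Finset.sum_comm]
    simp only [connMat, Finset.sum_mul_sum, smul_mul_smul_comm, mul_comm]
  have h3 : ∑ j, ∑ l, (jac F u l c * jac F u j d) • mpd l (chrMat H j) (F u) =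
      ∑ l, ∑ j, (jac F u l c * jac F u j d) • mpd l (chrMat H j) (F u) := Finset.sum_comm
  have h4 : ∑ j, ∑ l, (jac F u l d * jac F u j c) • mpd l (chrMat H j) (F u) =
      ∑ l, ∑ j, (jac F u l c * jac F u j d) • mpd j (chrMat H l) (F u) :=
    Finset.sum_congr rfl fun l _ => Finset.sum_congr rfl fun j _ => by rw [mul_comm]
  rw [hi.mpd_connMat hu, hi.mpd_connMat hu, h1, h2, h3, h4]
  simp only [curvMat_eq, smul_add, smul_sub, Finset.sum_add_distrib, Finset.sum_sub_distrib, hsymm]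
  abel

/-- The Gauss equation. -/
theorem gauss_equation (hi : IsIsometricOn U W F G H) (hu : u ∈ U) (c d : Fin n) :
    (jac F u)ᵀ * (H (F u) *
      ((∑ l, ∑ j, (jac F u l c * jac F u j d) • curvMat H l j (F u)) * jac F u)) =
    G u * curvMat G c d u - (sff H G F c u)ᵀ * (H (F u) * sff H G F d u)
      + (sff H G F d u)ᵀ * (H (F u) * sff H G F c u) := by
  have hO := hi.isOpen_source
  -- the derivative of `∂_d E = E Γ_d + K_d - A_d E`
  have hder : ∀ c d, mpd c (mpd d (jac F)) u =
      (jac F u * chrMat G c u + sff H G F c u - connMat H F c u * jac F u) * chrMat G d u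
        + jac F u * mpd c (chrMat G d) u + mpd c (sff H G F d) u
        - (mpd c (connMat H F d) u * jac F u + connMat H F d u *
          (jac F u * chrMat G c u + sff H G F c u - connMat H F c u * jac F u)) := by
    intro c d
    have e : mpd d (jac F) = fun v =>
        jac F v * chrMat G d v + sff H G F d v - connMat H F d v * jac F v :=
      funext fun v => mpd_jac (H := H) (G := G) d
    rw [e, mpd_sub hO hu ((hi.smooth_jac.mul (hi.smooth_chrMat_source d)).add (hi.smooth_sff d))
        ((hi.smooth_connMat d).mul hi.smooth_jac),
      mpd_add hO hu (hi.smooth_jac.mul (hi.smooth_chrMat_source d)) (hi.smooth_sff d),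
      mpd_mul hO hu hi.smooth_jac (hi.smooth_chrMat_source d),
      mpd_mul hO hu (hi.smooth_connMat d) hi.smooth_jac, mpd_jac (H := H) (G := G) c]
  -- the derivative of `Eᵀ H K_d = 0`
  have hnor : ∀ c d, (jac F u)ᵀ * (H (F u) * mpd c (sff H G F d) u) =
      - ((sff H G F c u)ᵀ * (H (F u) * sff H G F d u))
      - (jac F u)ᵀ * (H (F u) * (connMat H F c u * sff H G F d u)) := by
    intro c d
    have h0 := mpd_congr (A' := fun _ => 0) c
      (Filter.eventually_of_mem (hO.mem_nhds hu) fun v hv => hi.normal_sff hv d)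
    rw [mpd_const, mpd_mul hO hu hi.smooth_jac.transpose
        ((hi.smooth_comp hi.smooth).mul (hi.smooth_sff d)),
      mpd_mul hO hu (hi.smooth_comp hi.smooth) (hi.smooth_sff d), hi.mpd_metric_comp hu,
      mpd_transpose, mpd_jac (H := H) (G := G) c] at h0
    have h1 := hi.normal_sff hu d
    simp only [Matrix.transpose_add, Matrix.transpose_sub, Matrix.transpose_mul, Matrix.mul_add,
      Matrix.add_mul, Matrix.sub_mul, Matrix.mul_assoc, h1, Matrix.mul_zero, zero_add] at h0
    rw [← sub_eq_zero, ← h0]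
    abel
  -- The integrability condition `∂_c ∂_d E = ∂_d ∂_c E`, projected to the tangent space by `Eᵀ H`;
  -- the Gauss equation is its tangential part.
  have hcomm := congrArg (fun X => (jac F u)ᵀ * (H (F u) * X))
    (mpd_comm hO hu hi.smooth_jac c d)
  simp only [hder] at hcomm
  have hG := hi.metric_eq u hu
  have hKc := hi.normal_sff hu c
  have hKd := hi.normal_sff hu d
  rw [← hi.curvature_connMat hu, curvMat_eq, hG]
  -- Normality in right-associated form, so that `simp` can discard `K` in front of further factors.
  have hKd' : ∀ X : Matrix (Fin n) (Fin n) ℝ,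
      (jac F u)ᵀ * (H (F u) * (sff H G F d u * X)) = 0 := fun X => by
    rw [← Matrix.mul_assoc (H _), ← Matrix.mul_assoc, hKd, Matrix.zero_mul]
  have hKc' : ∀ X : Matrix (Fin n) (Fin n) ℝ,
      (jac F u)ᵀ * (H (F u) * (sff H G F c u * X)) = 0 := fun X => by
    rw [← Matrix.mul_assoc (H _), ← Matrix.mul_assoc, hKc, Matrix.zero_mul]
  simp only [Matrix.mul_add, Matrix.mul_sub, Matrix.add_mul, Matrix.sub_mul, Matrix.mul_assoc,
    hnor, hKc', hKd'] at hcomm ⊢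
  rw [← sub_eq_zero] at hcomm ⊢
  -- The difference of the two sides of the goal is minus that of the integrability condition.
  rw [← neg_eq_zero, ← hcomm]
  abel

end IsIsometricOn

end Immersion

/-! ### The derivative of the tangential projection -/

section Projection

open Matrix

variable {m n : ℕ}

/-- For the second fundamental form `K`, the covariant derivative `K_b g⁻¹ Eᵀ + E g⁻¹ K_bᵀ` of the
tangential projection `E g⁻¹ Eᵀ`. -/
def projDeriv (E : Matrix (Fin m) (Fin n) ℝ) (Gi : Matrix (Fin n) (Fin n) ℝ)
    (K : Matrix (Fin m) (Fin n) ℝ) : Matrix (Fin m) (Fin m) ℝ :=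
  K * (Gi * Eᵀ) + E * (Gi * Kᵀ)

namespace IsIsometricOn

variable {U : Set (EuclideanSpace ℝ (Fin n))} {W : Set (EuclideanSpace ℝ (Fin m))}
  {F : EuclideanSpace ℝ (Fin n) → EuclideanSpace ℝ (Fin m)}
  {G : EuclideanSpace ℝ (Fin n) → Matrix (Fin n) (Fin n) ℝ}
  {H : EuclideanSpace ℝ (Fin m) → Matrix (Fin m) (Fin m) ℝ}
  {u : EuclideanSpace ℝ (Fin n)}

theorem smooth_inv_source (hi : IsIsometricOn U W F G H) : SmoothMat (fun v => (G v)⁻¹) U :=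
  hi.smooth_source.inv hi.det_source

theorem smooth_inv_target (hi : IsIsometricOn U W F G H) :
    SmoothMat (fun v => (H (F v))⁻¹) U :=
  hi.smooth_comp (hi.smooth.inv hi.det_target)

theorem smooth_proj (hi : IsIsometricOn U W F G H) :
    SmoothMat (fun v => jac F v * ((G v)⁻¹ * (jac F v)ᵀ)) U :=
  hi.smooth_jac.mul (hi.smooth_inv_source.mul hi.smooth_jac.transpose)

/-- Since `∂g⁻¹ = -(g⁻¹ Γᵀ + Γ g⁻¹)`, the tangential terms of the structure equation cancel on both
sides of `g⁻¹`. The connection terms cancel against the correction in `∇̄`, and only `K` survives.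
-/
theorem nabla_proj (hi : IsIsometricOn U W F G H) (hu : u ∈ U) (b : Fin n) :
    mpd b (fun v => jac F v * ((G v)⁻¹ * (jac F v)ᵀ)) u
      + connMat H F b u * (jac F u * ((G u)⁻¹ * (jac F u)ᵀ))
      + (jac F u * ((G u)⁻¹ * (jac F u)ᵀ)) * (connMat H F b u)ᵀ =
    projDeriv (jac F u) (G u)⁻¹ (sff H G F b u) := by
  have hO := hi.isOpen_source
  have hd := (hi.det_source u hu).isUnit
  rw [mpd_mul hO hu hi.smooth_jac (hi.smooth_inv_source.mul hi.smooth_jac.transpose),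
    mpd_mul hO hu hi.smooth_inv_source hi.smooth_jac.transpose,
    mpd_inv hO hu hi.smooth_source hi.det_source, mpd_transpose,
    mpd_jac (H := H) (G := G) b, mpd_metric hi.symm_source (hi.det_source u hu), projDeriv]
  simp only [Matrix.transpose_add, Matrix.transpose_sub, Matrix.transpose_mul, Matrix.mul_add,
    Matrix.mul_sub, Matrix.sub_mul, Matrix.add_mul, Matrix.mul_assoc, Matrix.neg_mul,
    Matrix.mul_neg, Matrix.nonsing_inv_mul_cancel_left _ _ hd,
    Matrix.mul_nonsing_inv_cancel_left _ _ hd, neg_add]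
  abel

/-- The inverse metric is parallel because the metric is. -/
theorem nabla_inv (hi : IsIsometricOn U W F G H) (hu : u ∈ U) (b : Fin n) :
    mpd b (fun v => (H (F v))⁻¹) u + connMat H F b u * (H (F u))⁻¹
      + (H (F u))⁻¹ * (connMat H F b u)ᵀ = 0 := by
  have hd := (hi.det_target _ (hi.mapsTo hu)).isUnit
  rw [mpd_inv (A := fun v => H (F v)) hi.isOpen_source hu (hi.smooth_comp hi.smooth)
    (fun v hv => hi.det_target _ (hi.mapsTo hv)), hi.mpd_metric_comp hu]
  simp only [Matrix.mul_add, Matrix.add_mul, Matrix.mul_assoc, Matrix.mul_nonsing_inv _ hd,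
    Matrix.nonsing_inv_mul_cancel_left _ _ hd, neg_add, Matrix.mul_one]
  abel

/-- The covariant derivative of the normal projection with upper indices. -/
theorem nabla_normal_up (hi : IsIsometricOn U W F G H) (hu : u ∈ U) (b : Fin n) :
    mpd b (fun v => (H (F v))⁻¹ - jac F v * ((G v)⁻¹ * (jac F v)ᵀ)) u
      + connMat H F b u * ((H (F u))⁻¹ - jac F u * ((G u)⁻¹ * (jac F u)ᵀ))
      + ((H (F u))⁻¹ - jac F u * ((G u)⁻¹ * (jac F u)ᵀ)) * (connMat H F b u)ᵀ =
    -projDeriv (jac F u) (G u)⁻¹ (sff H G F b u) := by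
  rw [mpd_sub hi.isOpen_source hu hi.smooth_inv_target hi.smooth_proj, ← hi.nabla_proj hu,
    ← sub_eq_zero, ← hi.nabla_inv hu b]
  simp only [Matrix.mul_sub, Matrix.sub_mul]
  abel

/-- The covariant derivative of the normal projection with lower indices. -/
theorem nabla_normal_low (hi : IsIsometricOn U W F G H) (hu : u ∈ U) (b : Fin n) :
    mpd b (fun v => H (F v) - H (F v) * (jac F v * ((G v)⁻¹ * (jac F v)ᵀ)) * H (F v)) u
      - (connMat H F b u)ᵀ *
        (H (F u) - H (F u) * (jac F u * ((G u)⁻¹ * (jac F u)ᵀ)) * H (F u))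
      - (H (F u) - H (F u) * (jac F u * ((G u)⁻¹ * (jac F u)ᵀ)) * H (F u)) * connMat H F b u =
    -(H (F u) * projDeriv (jac F u) (G u)⁻¹ (sff H G F b u) * H (F u)) := by
  have hO := hi.isOpen_source
  have hH := hi.smooth_comp hi.smooth
  rw [mpd_sub hO hu hH ((hH.mul hi.smooth_proj).mul hH),
    mpd_mul hO hu (hH.mul hi.smooth_proj) hH, mpd_mul hO hu hH hi.smooth_proj,
    hi.mpd_metric_comp hu, ← hi.nabla_proj hu]
  simp only [Matrix.mul_sub, Matrix.sub_mul, Matrix.mul_add, Matrix.add_mul, Matrix.mul_assoc]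
  abel

end IsIsometricOn

end Projection

/-! ### Contractions -/

section Contractions

open Matrix

variable {m n : ℕ} {E L : Matrix (Fin m) (Fin n) ℝ} {H Hi : Matrix (Fin m) (Fin m) ℝ}
  {Gi : Matrix (Fin n) (Fin n) ℝ} {K : Fin n → Matrix (Fin m) (Fin n) ℝ}

theorem sum_mul_mul_apply {p q r s : ℕ} (A : Matrix (Fin p) (Fin q) ℝ)
    (Q : Matrix (Fin p) (Fin r) ℝ) (B : Matrix (Fin r) (Fin s) ℝ) (a : Fin q) (b : Fin s) :
    (Aᵀ * (Q * B)) a b = ∑ i, ∑ j, Q i j * A i a * B j b := by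
  simp only [Matrix.mul_apply, Matrix.transpose_apply, Finset.mul_sum]
  exact Finset.sum_congr rfl fun i _ => Finset.sum_congr rfl fun j _ => by ring

/-- A family of matrices `∇_k T` which is determined by its contractions with tangent vectors. -/
def liftDeriv (L : Matrix (Fin m) (Fin n) ℝ) (T : Fin n → Matrix (Fin m) (Fin m) ℝ) (k : Fin m) :
    Matrix (Fin m) (Fin m) ℝ :=
  ∑ b, L k b • T b

theorem liftDeriv_apply (T : Fin n → Matrix (Fin m) (Fin m) ℝ) (k i j : Fin m) :
    liftDeriv L T k i j = ∑ b, L k b * T b i j := by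
  simp [liftDeriv, Matrix.sum_apply]

/-- Duality of `L` and `E`: contracting the derivative index with a tangent vector recovers the
derivative along it. -/
theorem sum_liftDeriv (hL : Lᵀ * E = 1) (T : Fin n → Matrix (Fin m) (Fin m) ℝ) (b : Fin n)
    (i j : Fin m) : ∑ k, liftDeriv L T k i j * E k b = T b i j := by
  have h : ∀ c, ∑ k, L k c * E k b = (1 : Matrix (Fin n) (Fin n) ℝ) c b := fun c => by
    rw [← hL]; rfl
  simp only [liftDeriv_apply, Finset.sum_mul]
  rw [Finset.sum_comm]
  have : ∀ c, ∑ k, L k c * T c i j * E k b = T c i j * (1 : Matrix (Fin n) (Fin n) ℝ) c b :=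
    fun c => by
      rw [← h, Finset.mul_sum]
      exact Finset.sum_congr rfl fun k _ => by ring
  simp only [this]
  simp [Matrix.one_apply]

/-- The derivative index lies in the range of `L`, where `P` and `Hi` agree. This allows `η^{ij}` in
place of `𝒟^{ij}` in the scalar curvature. -/
theorem mul_liftDeriv (P : Matrix (Fin m) (Fin m) ℝ) (hP : P * L = Hi * L)
    (T : Fin n → Matrix (Fin m) (Fin m) ℝ) (i k l : Fin m) :
    ∑ j, P i j * liftDeriv L T j k l = ∑ j, Hi i j * liftDeriv L T j k l := by
  have h : ∀ Q : Matrix (Fin m) (Fin m) ℝ,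
      ∑ j, Q i j * liftDeriv L T j k l = ∑ b, (Q * L) i b * T b k l := by
    intro Q
    simp only [liftDeriv_apply, Finset.mul_sum, Matrix.mul_apply, Finset.sum_mul]
    rw [Finset.sum_comm]
    exact Finset.sum_congr rfl fun b _ => Finset.sum_congr rfl fun j _ => by ring
  rw [h, h, hP]

/-- The contraction `(∇_k Π^{kl}) (∇_j Π_{il})` along tangent vectors. -/
theorem contraction_mean (hL : Lᵀ * E = 1) (A B : Fin n → Matrix (Fin m) (Fin m) ℝ)
    (a b : Fin n) :
    ∑ i, ∑ j, (∑ k, ∑ l, liftDeriv L A k k l * liftDeriv L B j i l) * E i a * E j b =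
      ∑ c, (Lᵀ * (A c * (Eᵀ * B b)ᵀ)) c a := by
  have h1 : ∀ l, ∑ k, liftDeriv L A k k l = ∑ c, (Lᵀ * A c) c l := by
    intro l
    simp only [liftDeriv_apply, Matrix.mul_apply, Matrix.transpose_apply]
    exact Finset.sum_comm
  calc _ = ∑ l, (∑ k, liftDeriv L A k k l) * ∑ i, (∑ j, liftDeriv L B j i l * E j b) * E i a := by
        simp only [Finset.sum_mul, Finset.mul_sum]
        rw [Finset.sum_congr rfl fun i _ => Finset.sum_congr rfl fun j _ => Finset.sum_comm,
          Finset.sum_congr rfl fun i _ => Finset.sum_comm, Finset.sum_comm]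
        refine Finset.sum_congr rfl fun l _ => Finset.sum_congr rfl fun i _ =>
          Finset.sum_congr rfl fun j _ => Finset.sum_congr rfl fun k _ => by ring
    _ = ∑ l, (∑ c, (Lᵀ * A c) c l) * (Eᵀ * B b) a l := by
        refine Finset.sum_congr rfl fun l _ => ?_
        rw [h1]
        simp only [sum_liftDeriv hL, Matrix.mul_apply, Matrix.transpose_apply]
        simp only [mul_comm]
    _ = _ := by
        simp only [← Matrix.mul_assoc]
        simp only [Finset.sum_mul]
        rw [Finset.sum_comm]
        exact Finset.sum_congr rfl fun c _ => by
          rw [Matrix.mul_apply]; simp only [Matrix.transpose_apply]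

/-- The contraction `(∇_k Π_{li}) (∇_j Π^{lk})` along tangent vectors. -/
theorem contraction_sff (hL : Lᵀ * E = 1) (A B : Fin n → Matrix (Fin m) (Fin m) ℝ)
    (a b : Fin n) :
    ∑ i, ∑ j, (∑ k, ∑ l, liftDeriv L B k l i * liftDeriv L A j l k) * E i a * E j b =
      ∑ c, ((B c * E)ᵀ * (A b * L)) a c := by
  calc _ = ∑ k, ∑ l, ∑ i, liftDeriv L B k l i * E i a * ∑ j, liftDeriv L A j l k * E j b := by
        simp only [Finset.sum_mul, Finset.mul_sum]
        rw [Finset.sum_congr rfl fun i _ => Finset.sum_comm, Finset.sum_comm]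
        refine Finset.sum_congr rfl fun k _ => ?_
        rw [Finset.sum_congr rfl fun i _ => Finset.sum_comm, Finset.sum_comm]
        refine Finset.sum_congr rfl fun l _ => Finset.sum_congr rfl fun i _ =>
          Finset.sum_congr rfl fun j _ => by ring
    _ = ∑ k, ∑ l, ∑ c, L k c * (B c * E) l a * A b l k := by
        refine Finset.sum_congr rfl fun k _ => Finset.sum_congr rfl fun l _ => ?_
        simp only [sum_liftDeriv hL]
        simp only [liftDeriv_apply, Matrix.mul_apply, Finset.sum_mul, Finset.mul_sum]
        rw [Finset.sum_comm]
        exact Finset.sum_congr rfl fun c _ => Finset.sum_congr rfl fun i _ => by ring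
    _ = _ := by
        rw [Finset.sum_congr rfl fun k _ => Finset.sum_comm, Finset.sum_comm]
        refine Finset.sum_congr rfl fun c _ => ?_
        rw [Finset.sum_comm, Matrix.mul_apply]
        refine Finset.sum_congr rfl fun l _ => ?_
        rw [Matrix.mul_apply (M := A b), Finset.mul_sum, Matrix.transpose_apply]
        exact Finset.sum_congr rfl fun k _ => by ring

/-- The contraction `𝒟^{kl} R̄_{kilj}` along tangent vectors. -/
theorem contraction_curvature (P : Matrix (Fin m) (Fin m) ℝ) (hP : P = E * (Gi * Eᵀ))
    (hPs : Pᵀ = P) (R : Fin m → Fin m → Matrix (Fin m) (Fin m) ℝ) (a b : Fin n) :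
    ∑ i, ∑ j, (∑ k, ∑ l, P k l * (H * R l j) k i) * E i a * E j b =
      ∑ c, (Gi * (Eᵀ * (H * ((∑ l, ∑ j, (E l c * E j b) • R l j) * E)))) c a := by
  have h1 : ∀ c, (Gi * (Eᵀ * (H * ((∑ l, ∑ j, (E l c * E j b) • R l j) * E)))) c a =
      ∑ l, ∑ j, E j b * ∑ k, (E l c * (Gi * Eᵀ) c k) * (H * R l j * E) k a := by
    intro c
    simp only [Matrix.sum_mul, Matrix.mul_sum, Matrix.sum_apply, Matrix.smul_mul, Matrix.mul_smul,
      Matrix.smul_apply, smul_eq_mul]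
    refine Finset.sum_congr rfl fun l _ => Finset.sum_congr rfl fun j _ => ?_
    have : Gi * (Eᵀ * (H * (R l j * E))) = (Gi * Eᵀ) * (H * R l j * E) := by
      simp only [Matrix.mul_assoc]
    rw [this, Matrix.mul_apply, Finset.mul_sum, Finset.mul_sum]
    exact Finset.sum_congr rfl fun k _ => by ring
  -- The trace over the tangent index `c` produces the projection; its symmetry puts the indices in
  -- the order `k`, `l`.
  have h2 : ∀ l k, ∑ c, E l c * (Gi * Eᵀ) c k = P k l := by
    intro l k
    rw [← Matrix.mul_apply, ← hP]
    exact congrFun (congrFun hPs k) l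
  have h3 : ∀ l j, ∑ c, E j b * ∑ k, (E l c * (Gi * Eᵀ) c k) * (H * R l j * E) k a =
      ∑ i, ∑ k, P k l * (H * R l j) k i * E i a * E j b := by
    intro l j
    have h4 : ∀ k, ∑ c, E l c * (Gi * Eᵀ) c k * (H * R l j * E) k a =
        P k l * (H * R l j * E) k a := fun k => by rw [← Finset.sum_mul, h2]
    rw [← Finset.mul_sum, Finset.sum_comm]
    simp only [h4]
    rw [Finset.mul_sum, Finset.sum_comm]
    refine Finset.sum_congr rfl fun k _ => ?_
    rw [Matrix.mul_apply, Finset.mul_sum, Finset.mul_sum]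
    exact Finset.sum_congr rfl fun i _ => by ring
  simp only [h1]
  symm
  rw [Finset.sum_comm, Finset.sum_congr rfl fun l _ => Finset.sum_comm]
  simp only [h3, Finset.sum_mul]
  rw [Finset.sum_congr rfl fun l _ => Finset.sum_comm, Finset.sum_comm]
  refine Finset.sum_congr rfl fun i _ => ?_
  rw [Finset.sum_comm]
  exact Finset.sum_congr rfl fun j _ => Finset.sum_comm

end Contractions

/-! ### Ricci and scalar curvature of an isometric immersion -/

section RicciScalar

open Matrix

variable {m n : ℕ}

/-- `H_{kp} E^p_a g^{ab}`. -/
def coframe (E : Matrix (Fin m) (Fin n) ℝ) (H : Matrix (Fin m) (Fin m) ℝ)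
    (Gi : Matrix (Fin n) (Fin n) ℝ) : Matrix (Fin m) (Fin n) ℝ :=
  H * (E * Gi)

theorem curvatureLow_eq {d : ℕ} (H : EuclideanSpace ℝ (Fin d) → Matrix (Fin d) (Fin d) ℝ)
    (i j k l : Fin d) (w : EuclideanSpace ℝ (Fin d)) :
    curvatureLow H i j k l w = (H w * curvMat H k l w) i j := by
  simp only [curvatureLow, Matrix.mul_apply, curvMat, Matrix.of_apply]

theorem connMat_apply (H : EuclideanSpace ℝ (Fin m) → Matrix (Fin m) (Fin m) ℝ)
    (F : EuclideanSpace ℝ (Fin n) → EuclideanSpace ℝ (Fin m)) (b : Fin n)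
    (u : EuclideanSpace ℝ (Fin n)) (i q : Fin m) :
    connMat H F b u i q = ∑ l, jac F u l b * christoffel H i l q (F u) := by
  simp [connMat, Matrix.sum_apply, chrMat]

/-- The factor `∑ b, L k b * jac F u l b` is `𝒟_k^l`. Its contraction with the ambient symbols
gathers into the pulled back connection, lifted by `L`. -/
theorem sum_mul_connMat (L : Matrix (Fin m) (Fin n) ℝ)
    (H : EuclideanSpace ℝ (Fin m) → Matrix (Fin m) (Fin m) ℝ)
    (F : EuclideanSpace ℝ (Fin n) → EuclideanSpace ℝ (Fin m)) (u : EuclideanSpace ℝ (Fin n))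
    (t : Fin m → ℝ) (k i : Fin m) :
    ∑ l, (∑ b, L k b * jac F u l b) * ∑ q, christoffel H i l q (F u) * t q =
      ∑ b, L k b * ∑ q, connMat H F b u i q * t q := by
  simp only [connMat_apply, Finset.sum_mul, Finset.mul_sum]
  rw [Finset.sum_congr rfl fun q _ => Finset.sum_comm, Finset.sum_comm]
  refine Finset.sum_congr rfl fun b _ => ?_
  rw [Finset.sum_comm]
  exact Finset.sum_congr rfl fun q _ => Finset.sum_congr rfl fun l _ => by ring

/-- The covariant derivative of a tensor with upper indices in components. -/
theorem nabla_up_apply (L : Matrix (Fin m) (Fin n) ℝ)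
    (H : EuclideanSpace ℝ (Fin m) → Matrix (Fin m) (Fin m) ℝ)
    (F : EuclideanSpace ℝ (Fin n) → EuclideanSpace ℝ (Fin m)) (u : EuclideanSpace ℝ (Fin n))
    (D : Fin n → Matrix (Fin m) (Fin m) ℝ) (T : Matrix (Fin m) (Fin m) ℝ) (k i j : Fin m) :
    (∑ b, L k b * D b i j) + ∑ l, (∑ b, L k b * jac F u l b) *
        ∑ q, (christoffel H i l q (F u) * T q j + christoffel H j l q (F u) * T i q) =
      liftDeriv L (fun b => D b + connMat H F b u * T + T * (connMat H F b u)ᵀ) k i j := by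
  simp only [Finset.sum_add_distrib, mul_add, sum_mul_connMat, liftDeriv_apply, Matrix.add_apply,
    Matrix.mul_apply, Matrix.transpose_apply, add_assoc]
  simp only [mul_comm (T i _)]

/-- The covariant derivative of a tensor with lower indices in components. -/
theorem nabla_low_apply (L : Matrix (Fin m) (Fin n) ℝ)
    (H : EuclideanSpace ℝ (Fin m) → Matrix (Fin m) (Fin m) ℝ)
    (F : EuclideanSpace ℝ (Fin n) → EuclideanSpace ℝ (Fin m)) (u : EuclideanSpace ℝ (Fin n))
    (D : Fin n → Matrix (Fin m) (Fin m) ℝ) (T : Matrix (Fin m) (Fin m) ℝ) (k i j : Fin m) :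
    (∑ b, L k b * D b i j) - ∑ l, (∑ b, L k b * jac F u l b) *
        ∑ q, (christoffel H q l i (F u) * T q j + christoffel H q l j (F u) * T i q) =
      liftDeriv L (fun b => D b - (connMat H F b u)ᵀ * T - T * connMat H F b u) k i j := by
  have h : ∀ (i : Fin m) (t : Fin m → ℝ),
      ∑ l, (∑ b, L k b * jac F u l b) * ∑ q, christoffel H q l i (F u) * t q =
        ∑ b, L k b * ∑ q, connMat H F b u q i * t q := by
    intro i t
    simp only [Finset.mul_sum]
    rw [Finset.sum_comm, Finset.sum_comm (s := (Finset.univ : Finset (Fin n)))]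
    refine Finset.sum_congr rfl fun q _ => ?_
    -- For lower indices the summation index sits in the upper slot of the symbol; a vector
    -- supported at `i` extracts each term from the previous lemma.
    have := sum_mul_connMat L H F u (Pi.single i (t q)) k q
    simpa [Pi.single_apply] using this
  simp only [Finset.sum_add_distrib, mul_add, h, liftDeriv_apply, Matrix.sub_apply,
    Matrix.add_apply, Matrix.mul_apply, Matrix.transpose_apply, mul_sub, Finset.sum_sub_distrib, sub_sub]
  simp only [mul_comm (T i _)]

namespace IsIsometricOn

variable {U : Set (EuclideanSpace ℝ (Fin n))} {W : Set (EuclideanSpace ℝ (Fin m))}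
  {F : EuclideanSpace ℝ (Fin n) → EuclideanSpace ℝ (Fin m)}
  {G : EuclideanSpace ℝ (Fin n) → Matrix (Fin n) (Fin n) ℝ}
  {H : EuclideanSpace ℝ (Fin m) → Matrix (Fin m) (Fin m) ℝ}
  {u : EuclideanSpace ℝ (Fin n)}

/-- The product is `g⁻¹ (Eᵀ H E) = g⁻¹ g`. -/
theorem coframe_transpose_mul (hi : IsIsometricOn U W F G H) (hu : u ∈ U) :
    (coframe (jac F u) (H (F u)) (G u)⁻¹)ᵀ * jac F u = 1 := by
  rw [coframe, Matrix.transpose_mul, Matrix.transpose_mul, Matrix.transpose_nonsing_inv,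
    hi.symm_target, hi.symm_source, Matrix.mul_assoc, Matrix.mul_assoc, ← hi.metric_eq u hu,
    Matrix.nonsing_inv_mul _ (hi.det_source u hu).isUnit]

theorem transpose_mul_coframe (hi : IsIsometricOn U W F G H) (hu : u ∈ U) :
    (jac F u)ᵀ * coframe (jac F u) (H (F u)) (G u)⁻¹ = 1 := by
  rw [← Matrix.transpose_transpose (coframe _ _ _), ← Matrix.transpose_mul,
    hi.coframe_transpose_mul hu, Matrix.transpose_one]

/-- `∇_b Π^{ij}`. -/
def normalUp (_ : IsIsometricOn U W F G H) (u : EuclideanSpace ℝ (Fin n)) (b : Fin n) :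
    Matrix (Fin m) (Fin m) ℝ :=
  -projDeriv (jac F u) (G u)⁻¹ (sff H G F b u)

/-- `∇_b Π_{ij}`. -/
def normalLow (_ : IsIsometricOn U W F G H) (u : EuclideanSpace ℝ (Fin n)) (b : Fin n) :
    Matrix (Fin m) (Fin m) ℝ :=
  -(H (F u) * projDeriv (jac F u) (G u)⁻¹ (sff H G F b u) * H (F u))

theorem projDeriv_transpose (hi : IsIsometricOn U W F G H) (b : Fin n) :
    (projDeriv (jac F u) (G u)⁻¹ (sff H G F b u))ᵀ =
      projDeriv (jac F u) (G u)⁻¹ (sff H G F b u) := by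
  simp only [projDeriv, Matrix.transpose_add, Matrix.transpose_mul, Matrix.transpose_transpose,
    Matrix.transpose_nonsing_inv, hi.symm_source, Matrix.mul_assoc]
  exact add_comm _ _

theorem normalUp_transpose (hi : IsIsometricOn U W F G H) (b : Fin n) :
    (hi.normalUp u b)ᵀ = hi.normalUp u b := by
  rw [normalUp, Matrix.transpose_neg, hi.projDeriv_transpose]

theorem normalLow_transpose (hi : IsIsometricOn U W F G H) (b : Fin n) :
    (hi.normalLow u b)ᵀ = hi.normalLow u b := by
  rw [normalLow, Matrix.transpose_neg, Matrix.transpose_mul, Matrix.transpose_mul,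
    hi.projDeriv_transpose, hi.symm_target, Matrix.mul_assoc]

theorem sff_normal_left (hi : IsIsometricOn U W F G H) (hu : u ∈ U) (b : Fin n) :
    (sff H G F b u)ᵀ * (H (F u) * jac F u) = 0 := by
  have := congrArg Matrix.transpose (hi.normal_sff hu b)
  simpa only [Matrix.transpose_mul, Matrix.transpose_transpose, hi.symm_target,
    Matrix.transpose_zero, Matrix.mul_assoc] using this

/-- Of the two terms of `projDeriv`, one dies by normality of `K`; in the other `Eᵀ H E g⁻¹ = 1`. -/
theorem transpose_jac_mul_normalLow (hi : IsIsometricOn U W F G H) (hu : u ∈ U) (b : Fin n) :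
    (jac F u)ᵀ * hi.normalLow u b = -((sff H G F b u)ᵀ * H (F u)) := by
  have h1 : ∀ X : Matrix (Fin n) (Fin m) ℝ,
      (jac F u)ᵀ * (H (F u) * (sff H G F b u * X)) = 0 := fun X => by
    rw [← Matrix.mul_assoc (H _), ← Matrix.mul_assoc, hi.normal_sff hu, Matrix.zero_mul]
  have h2 : ∀ X : Matrix (Fin n) (Fin m) ℝ,
      (jac F u)ᵀ * (H (F u) * (jac F u * ((G u)⁻¹ * X))) = X := fun X => by
    rw [← Matrix.mul_assoc (H _), ← Matrix.mul_assoc, ← hi.metric_eq u hu,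
      Matrix.mul_nonsing_inv_cancel_left _ _ (hi.det_source u hu).isUnit]
  simp only [normalLow, projDeriv, Matrix.mul_neg, Matrix.mul_add, Matrix.add_mul,
    Matrix.mul_assoc, h1, h2, zero_add]

theorem normalLow_mul_jac (hi : IsIsometricOn U W F G H) (hu : u ∈ U) (b : Fin n) :
    hi.normalLow u b * jac F u = -(H (F u) * sff H G F b u) := by
  have := congrArg Matrix.transpose (hi.transpose_jac_mul_normalLow hu b)
  simpa only [Matrix.transpose_mul, Matrix.transpose_transpose, hi.symm_target,
    Matrix.transpose_neg, hi.normalLow_transpose] using this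

/-- The term `E g⁻¹ Kᵀ` is killed by `Kᵀ H E = 0`, while `Eᵀ L = 1` simplifies the other. -/
theorem normalUp_mul_coframe (hi : IsIsometricOn U W F G H) (hu : u ∈ U) (b : Fin n) :
    hi.normalUp u b * coframe (jac F u) (H (F u)) (G u)⁻¹ = -(sff H G F b u * (G u)⁻¹) := by
  have h1 : (sff H G F b u)ᵀ * (H (F u) * (jac F u * (G u)⁻¹)) = 0 := by
    rw [← Matrix.mul_assoc (H _), ← Matrix.mul_assoc, hi.sff_normal_left hu, Matrix.zero_mul]
  have h2 := hi.transpose_mul_coframe hu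
  rw [coframe] at h2
  simp only [normalUp, projDeriv, coframe, Matrix.neg_mul, Matrix.add_mul, Matrix.mul_assoc, h1,
    h2, Matrix.mul_zero, add_zero, Matrix.mul_one]

theorem coframe_transpose_mul_normalUp (hi : IsIsometricOn U W F G H) (hu : u ∈ U) (b : Fin n) :
    (coframe (jac F u) (H (F u)) (G u)⁻¹)ᵀ * hi.normalUp u b =
      -((G u)⁻¹ * (sff H G F b u)ᵀ) := by
  have := congrArg Matrix.transpose (hi.normalUp_mul_coframe hu b)
  simpa only [Matrix.transpose_mul, Matrix.transpose_transpose, hi.symm_source,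
    Matrix.transpose_neg, hi.normalUp_transpose, Matrix.transpose_nonsing_inv] using this

theorem proj_transpose (hi : IsIsometricOn U W F G H) :
    (jac F u * ((G u)⁻¹ * (jac F u)ᵀ))ᵀ = jac F u * ((G u)⁻¹ * (jac F u)ᵀ) := by
  simp only [Matrix.transpose_mul, Matrix.transpose_transpose, Matrix.transpose_nonsing_inv,
    hi.symm_source, Matrix.mul_assoc]

theorem curvMat_source (hi : IsIsometricOn U W F G H) (hu : u ∈ U) (c d : Fin n) :
    curvMat G c d u = (G u)⁻¹ * ((jac F u)ᵀ * (H (F u) *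
      ((∑ l, ∑ j, (jac F u l c * jac F u j d) • curvMat H l j (F u)) * jac F u)))
      + (G u)⁻¹ * ((sff H G F c u)ᵀ * (H (F u) * sff H G F d u))
      - (G u)⁻¹ * ((sff H G F d u)ᵀ * (H (F u) * sff H G F c u)) := by
  rw [hi.gauss_equation hu]
  simp only [Matrix.mul_add, Matrix.mul_sub,
    Matrix.nonsing_inv_mul_cancel_left _ _ (hi.det_source u hu).isUnit]
  abel

/-- The contracted Gauss equation. -/
theorem ricciComp_eq (hi : IsIsometricOn U W F G H) (hu : u ∈ U) (a b : Fin n) :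
    ricciComp G a b u = ∑ i, ∑ j, (∑ k, ∑ l,
      ((jac F u * ((G u)⁻¹ * (jac F u)ᵀ)) k l * curvatureLow H k i l j (F u)
        + liftDeriv (coframe (jac F u) (H (F u)) (G u)⁻¹) (hi.normalUp u) k k l
          * liftDeriv (coframe (jac F u) (H (F u)) (G u)⁻¹) (hi.normalLow u) j i l
        - liftDeriv (coframe (jac F u) (H (F u)) (G u)⁻¹) (hi.normalLow u) k l i
          * liftDeriv (coframe (jac F u) (H (F u)) (G u)⁻¹) (hi.normalUp u) j l k))
      * jac F u i a * jac F u j b := by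
  have hL := hi.coframe_transpose_mul hu
  simp only [Finset.sum_add_distrib, Finset.sum_sub_distrib, add_mul, sub_mul]
  rw [contraction_mean hL, contraction_sff hL]
  simp only [curvatureLow_eq]
  rw [contraction_curvature _ rfl hi.proj_transpose (fun l j => curvMat H l j (F u))]
  have h1 : ricciComp G a b u = ∑ c, (curvMat G c b u) c a := rfl
  rw [h1, ← Finset.sum_add_distrib, ← Finset.sum_sub_distrib]
  refine Finset.sum_congr rfl fun c _ => ?_
  rw [hi.curvMat_source hu, Matrix.sub_apply, Matrix.add_apply]
  congr 1
  · congr 1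
    rw [hi.transpose_jac_mul_normalLow hu, ← Matrix.mul_assoc (coframe _ _ _)ᵀ,
      hi.coframe_transpose_mul_normalUp hu]
    simp only [Matrix.transpose_neg, Matrix.transpose_mul, Matrix.transpose_transpose,
      hi.symm_target, Matrix.neg_mul, Matrix.mul_neg, neg_neg, Matrix.mul_assoc]
  · rw [hi.normalLow_mul_jac hu, hi.normalUp_mul_coframe hu]
    simp only [Matrix.transpose_neg, Matrix.neg_mul, Matrix.mul_neg, neg_neg]
    -- The contraction gives the entry `(a, c)` of `K_cᵀ H K_b g⁻¹`, the Gauss equation the entry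
    -- `(c, a)` of its transpose.
    refine Eq.trans ?_ (Matrix.transpose_apply _ c a)
    simp only [Matrix.transpose_mul, Matrix.transpose_transpose, Matrix.transpose_nonsing_inv,
      hi.symm_source, hi.symm_target, Matrix.mul_assoc]

/-- The scalar curvature of an isometric immersion. -/
theorem scalar_eq (hi : IsIsometricOn U W F G H) (hu : u ∈ U) :
    ∑ a, ∑ b, (G u)⁻¹ a b * ricciComp G a b u =
      (∑ i, ∑ j, ∑ k, ∑ l, (jac F u * ((G u)⁻¹ * (jac F u)ᵀ)) i j
        * (jac F u * ((G u)⁻¹ * (jac F u)ᵀ)) k l * curvatureLow H k i l j (F u))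
      + (∑ l, (∑ k, ∑ r, (H (F u))⁻¹ k r *
          liftDeriv (coframe (jac F u) (H (F u)) (G u)⁻¹) (hi.normalLow u) r k l)
        * ∑ i, liftDeriv (coframe (jac F u) (H (F u)) (G u)⁻¹) (hi.normalUp u) i i l)
      - ∑ i, ∑ k, ∑ l, liftDeriv (coframe (jac F u) (H (F u)) (G u)⁻¹) (hi.normalLow u) k i l
        * ∑ r, (H (F u))⁻¹ i r *
          liftDeriv (coframe (jac F u) (H (F u)) (G u)⁻¹) (hi.normalUp u) r k l := by
  set P := jac F u * ((G u)⁻¹ * (jac F u)ᵀ) with hPdef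
  set L := coframe (jac F u) (H (F u)) (G u)⁻¹ with hLdef
  have hP : ∀ i j, P i j = ∑ a, ∑ b, (G u)⁻¹ a b * jac F u i a * jac F u j b := by
    intro i j
    have := sum_mul_mul_apply (jac F u)ᵀ (G u)⁻¹ (jac F u)ᵀ i j
    rw [Matrix.transpose_transpose] at this
    rw [hPdef, this]
    simp only [Matrix.transpose_apply]
  have hPL : P * L = (H (F u))⁻¹ * L := by
    rw [hPdef, hLdef, Matrix.mul_assoc, Matrix.mul_assoc, hi.transpose_mul_coframe hu,
      Matrix.mul_one, coframe,
      Matrix.nonsing_inv_mul_cancel_left _ _ (hi.det_target _ (hi.mapsTo hu)).isUnit]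
  have hsymm : ∀ T : Fin n → Matrix (Fin m) (Fin m) ℝ, (∀ b, (T b)ᵀ = T b) →
      ∀ k i j, liftDeriv L T k i j = liftDeriv L T k j i := by
    intro T hT k i j
    simp only [liftDeriv_apply]
    exact Finset.sum_congr rfl fun b _ => by
      rw [← congrFun (congrFun (hT b) i) j, Matrix.transpose_apply]
  -- Tracing a pulled back form with `g^{ab}` amounts to contracting the ambient form with the
  -- tangential projection.
  have hQ : ∀ Q : Fin m → Fin m → ℝ, ∑ a, ∑ b, (G u)⁻¹ a b *
      (∑ i, ∑ j, Q i j * jac F u i a * jac F u j b) = ∑ i, ∑ j, P i j * Q i j := by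
    intro Q
    simp only [hP, Finset.mul_sum, Finset.sum_mul]
    rw [Finset.sum_congr rfl fun a _ => Finset.sum_comm, Finset.sum_comm]
    refine Finset.sum_congr rfl fun i _ => ?_
    rw [Finset.sum_congr rfl fun a _ => Finset.sum_comm, Finset.sum_comm]
    refine Finset.sum_congr rfl fun j _ => Finset.sum_congr rfl fun a _ =>
      Finset.sum_congr rfl fun b _ => by ring
  simp only [hi.ricciComp_eq hu, ← hPdef, ← hLdef]
  rw [hQ]
  simp only [Finset.sum_add_distrib, Finset.sum_sub_distrib, mul_add, mul_sub]
  congr 1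
  · congr 1
    · simp only [Finset.mul_sum, mul_assoc]
    -- Each `η^{ij}` acting on a derivative index is traded for the projection, which is what the
    -- trace of the Ricci formula contains.
    · simp only [← mul_liftDeriv P hPL]
      calc _ = ∑ i, ∑ j, ∑ l, P i j * liftDeriv L (hi.normalLow u) j i l *
              ∑ k, liftDeriv L (hi.normalUp u) k k l := by
            refine Finset.sum_congr rfl fun i _ => Finset.sum_congr rfl fun j _ => ?_
            rw [Finset.sum_comm, Finset.mul_sum]
            refine Finset.sum_congr rfl fun l _ => ?_
            rw [Finset.mul_sum, Finset.mul_sum]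
            exact Finset.sum_congr rfl fun k _ => by ring
        _ = _ := by
            rw [Finset.sum_congr rfl fun i _ => Finset.sum_comm, Finset.sum_comm]
            simp only [Finset.sum_mul]
  · simp only [← mul_liftDeriv P hPL, Finset.mul_sum]
    refine Finset.sum_congr rfl fun i _ => ?_
    rw [Finset.sum_comm]
    refine Finset.sum_congr rfl fun k _ => ?_
    rw [Finset.sum_comm]
    refine Finset.sum_congr rfl fun l _ => Finset.sum_congr rfl fun j _ => ?_
    rw [hsymm _ hi.normalLow_transpose k l i, hsymm _ hi.normalUp_transpose j l k]
    ring

end IsIsometricOn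

end RicciScalar

/-! ### Hadamard's lemma -/

section Hadamard

open MeasureTheory

/-- The integral is the value at `0` of the convolution of the indicator of `(0, 1]` with `s ↦ χ s *
g x (-s)`. Smooth dependence on the parameter `x` is then a property of convolutions with compactly
supported smooth kernels. -/
theorem contDiff_integral_unitInterval {E : Type*} [NormedAddCommGroup E] [NormedSpace ℝ E]
    {g : E → ℝ → ℝ} (hg : ContDiff ℝ ∞ (fun q : E × ℝ => g q.1 q.2)) :
    ContDiff ℝ ∞ (fun x => ∫ t in (0 : ℝ)..1, g x t) := by
  -- The cutoff equals `1` on `[-1, 1]`, which contains every `-t` with `t` in `(0, 1]`, and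
  -- vanishes outside the ball of radius `2`.
  let χ : ContDiffBump (0 : ℝ) := ⟨1, 2, one_pos, one_lt_two⟩
  let f : ℝ → ℝ := (Set.Ioc (0 : ℝ) 1).indicator 1
  have hf : LocallyIntegrable f volume := by
    have : Integrable f volume :=
      (integrable_indicator_iff measurableSet_Ioc).2 (integrableOn_const (by simp))
    exact this.locallyIntegrable
  have hsm : ContDiff ℝ ∞ (fun q : E × ℝ => χ q.2 * g q.1 (-q.2)) :=
    (χ.contDiff.comp contDiff_snd).mul (hg.comp (contDiff_fst.prodMk contDiff_snd.neg))
  have key := contDiffOn_convolution_right_with_param_comp (𝕜 := ℝ) (n := ⊤) (μ := volume)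
    (ContinuousLinearMap.mul ℝ ℝ) (s := (Set.univ : Set E)) (v := fun _ => (0 : ℝ))
    contDiffOn_const (f := f) (g := fun x s => χ s * g x (-s)) (k := Metric.closedBall 0 2)
    isOpen_univ (isCompact_closedBall _ _)
    (fun x s _ hs => by
      have : χ s = 0 := χ.zero_of_le_dist (by
        rw [Metric.mem_closedBall, not_le] at hs; exact hs.le)
      simp [this]) hf hsm.contDiffOn
  convert contDiffOn_univ.1 key using 1
  ext x
  rw [convolution_def, intervalIntegral.integral_of_le zero_le_one,
    ← integral_indicator measurableSet_Ioc]
  congr 1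
  ext t
  by_cases ht : t ∈ Set.Ioc (0 : ℝ) 1
  · have : χ (-t) = 1 := χ.one_of_mem_closedBall (by
      simp [χ, abs_of_pos ht.1, ht.2])
    simp [f, ht, this]
  · simp [f, ht]

/-- Hadamard's lemma. -/
theorem hadamard {d : ℕ} {h : EuclideanSpace ℝ (Fin d) → ℝ} (hh : ContDiff ℝ ∞ h)
    (u : EuclideanSpace ℝ (Fin d)) :
    ∃ g : Fin d → EuclideanSpace ℝ (Fin d) → ℝ, (∀ a, ContDiff ℝ ∞ (g a)) ∧
      (∀ a, g a u = pd a h u) ∧ ∀ v, h v = h u + ∑ a, (v a - u a) * g a v := by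
  have hpd : ∀ a, ContDiff ℝ ∞ (pd a h) := fun a =>
    contDiffOn_univ.1 (ContDiffOn.pd isOpen_univ a hh.contDiffOn)
  refine ⟨fun a v => ∫ t in (0 : ℝ)..1, pd a h (u + t • (v - u)), fun a => ?_, fun a => ?_,
    fun v => ?_⟩
  · exact contDiff_integral_unitInterval ((hpd a).comp
      (contDiff_const.add (contDiff_snd.smul (contDiff_fst.sub contDiff_const))))
  · simp
  · have hline : ∀ t : ℝ, HasDerivAt (fun t : ℝ => u + t • (v - u)) (v - u) t := fun t => by
      simpa using ((hasDerivAt_id t).smul_const (v - u)).const_add u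
    have hd : ∀ t : ℝ, HasDerivAt (fun t : ℝ => h (u + t • (v - u)))
        (∑ a, (v a - u a) * pd a h (u + t • (v - u))) t := by
      intro t
      have h1 := (hh.differentiable (by simp) (u + t • (v - u))).hasFDerivAt.comp_hasDerivAt t
        (hline t)
      have hv : v - u = ∑ a, (v a - u a) • (EuclideanSpace.single a (1 : ℝ)) :=
        eq_sum_single _
      have h2 : fderiv ℝ h (u + t • (v - u)) (v - u) =
          ∑ a, (v a - u a) * pd a h (u + t • (v - u)) := by
        generalize u + t • (v - u) = w
        rw [hv, map_sum]
        simp [pd]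
      rw [← h2]
      exact h1
    have hc : ∀ a, Continuous fun t : ℝ => pd a h (u + t • (v - u)) := fun a =>
      (hpd a).continuous.comp (by fun_prop)
    have hint := intervalIntegral.integral_eq_sub_of_hasDerivAt (a := 0) (b := 1)
      (fun t _ => hd t)
      (Continuous.intervalIntegrable (by
        exact continuous_finsetSum _ fun a _ => continuous_const.mul (hc a)) _ _)
    rw [intervalIntegral.integral_finsetSum (f := fun a (t : ℝ) =>
      (v a - u a) * pd a h (u + t • (v - u))) fun a _ =>
      (continuous_const.mul (hc a)).intervalIntegrable _ _] at hint
    simp only [intervalIntegral.integral_const_mul, one_smul, zero_smul, add_zero,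
      add_sub_cancel] at hint
    rw [hint]; ring

end Hadamard

/-! ### Point derivations and brackets in coordinates -/

section Derivations

theorem chartPd_congr {n : ℕ} {S : Type*} [TopologicalSpace S]
    {ψ : OpenPartialHomeomorph S (EuclideanSpace ℝ (Fin n))} {p : S}
    (hp : p ∈ ψ.source) {h h' : S → ℝ} (e : h =ᶠ[𝓝 p] h') (a : Fin n) :
    chartPd ψ a h p = chartPd ψ a h' p := by
  refine pd_congr a ?_
  have : Filter.Tendsto ψ.symm (𝓝 (ψ p)) (𝓝 p) := by
    have := ψ.continuousAt_symm (ψ.map_source hp)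
    rwa [ContinuousAt, ψ.left_inv hp] at this
  exact this.eventually e

variable {n N : ℕ} {S : Type*} [TopologicalSpace S] [ChartedSpace (EuclideanSpace ℝ (Fin n)) S]

/-- Multiply `h` by a bump function that is `1` near `p` and whose closed support lies where `h` is
smooth. -/
theorem exists_contMDiffMap_eventuallyEq [T2Space S] [IsManifold (𝓡 n) ∞ S] {p : S} {h : S → ℝ}
    (hh : ∀ᶠ q in 𝓝 p, ContMDiffAt (𝓡 n) 𝓘(ℝ) ∞ h q) :
    ∃ F : C^∞⟮𝓡 n, S; ℝ⟯, (F : S → ℝ) =ᶠ[𝓝 p] h := by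
  obtain ⟨s, hs, hs'⟩ := Filter.eventually_iff_exists_mem.1 hh
  obtain ⟨χ, hχ⟩ := (SmoothBumpFunction.nhds_basis_tsupport (I := 𝓡 n) p).mem_iff.1 hs
  refine ⟨⟨fun x => χ x * h x, contMDiff_of_tsupport fun x hx => ?_⟩, ?_⟩
  · exact χ.contMDiffAt.mul (hs' x (hχ.2 (tsupport_mul_subset_left hx)))
  · filter_upwards [χ.eventuallyEq_one] with x hx
    simp [hx]

theorem globalize_eventuallyEq [T2Space S] [IsManifold (𝓡 n) ∞ S] {p : S} {h : S → ℝ}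
    (hh : ∀ᶠ q in 𝓝 p, ContMDiffAt (𝓡 n) 𝓘(ℝ) ∞ h q) :
    (globalize (n := n) p h : S → ℝ) =ᶠ[𝓝 p] h := by
  have H := exists_contMDiffMap_eventuallyEq hh
  simp only [globalize, dif_pos H]
  exact H.choose_spec

theorem eventually_contMDiffAt_of_contDiffOn [IsManifold (𝓡 n) ∞ S]
    {ψ : OpenPartialHomeomorph S (EuclideanSpace ℝ (Fin n))}
    (hψ : ψ ∈ IsManifold.maximalAtlas (𝓡 n) ∞ S) {p : S} (hp : p ∈ ψ.source)
    {U : Set (EuclideanSpace ℝ (Fin n))} (hU : IsOpen U) (hpU : ψ p ∈ U)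
    {g : EuclideanSpace ℝ (Fin n) → ℝ} (hg : ContDiffOn ℝ ∞ g U) :
    ∀ᶠ q in 𝓝 p, ContMDiffAt (𝓡 n) 𝓘(ℝ) ∞ (fun q => g (ψ q)) q := by
  filter_upwards [ψ.open_source.mem_nhds hp, (ψ.continuousAt hp).eventually (hU.mem_nhds hpU)]
    with q hq hqU
  exact (hg.contDiffAt (hU.mem_nhds hqU)).contMDiffAt.comp q
    (contMDiffAt_of_mem_maximalAtlas hψ hq)

variable (D : C^∞⟮𝓡 n, S; ℝ⟯ →ₗ[ℝ] ℝ) {p : S}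

/-- If `a - b` vanishes near `p`, then `a - b = c (a - b)` for some `c` with `c p = 0`, and both
terms of the Leibniz rule vanish. -/
theorem derivation_congr [T2Space S] [IsManifold (𝓡 n) ∞ S]
    (hD : ∀ a b, D (a * b) = a p * D b + b p * D a) {a b : C^∞⟮𝓡 n, S; ℝ⟯}
    (h : (a : S → ℝ) =ᶠ[𝓝 p] b) : D a = D b := by
  have h0 : ((a - b : C^∞⟮𝓡 n, S; ℝ⟯) : S → ℝ) =ᶠ[𝓝 p] 0 := by
    filter_upwards [h] with x hx
    simp [ContMDiffMap.coe_sub, hx]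
  obtain ⟨s, hs, hs'⟩ := Filter.eventually_iff_exists_mem.1 h0
  obtain ⟨χ, hχ⟩ := (SmoothBumpFunction.nhds_basis_tsupport (I := 𝓡 n) p).mem_iff.1 hs
  let c : C^∞⟮𝓡 n, S; ℝ⟯ := ⟨fun x => 1 - χ x, contMDiff_const.sub χ.contMDiff⟩
  have hc : ∀ x, c x = 1 - χ x := fun _ => rfl
  have e : a - b = c * (a - b) := by
    ext x
    rw [ContMDiffMap.coe_mul, Pi.mul_apply, hc]
    by_cases hx : x ∈ s
    · simp [hs' x hx]
    · have : χ x = 0 := image_eq_zero_of_notMem_tsupport (fun h => hx (hχ.2 h))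
      simp [this]
  have h1 : D (a - b) = 0 := by
    rw [e, hD, h0.self_of_nhds, hc]
    simp
  rwa [map_sub, sub_eq_zero] at h1

theorem derivation_const (hD : ∀ a b, D (a * b) = a p * D b + b p * D a) (r : ℝ) :
    D (algebraMap ℝ _ r) = 0 := by
  have h1 := hD 1 1
  have h2 : (1 : C^∞⟮𝓡 n, S; ℝ⟯) p = 1 := rfl
  rw [mul_one, h2] at h1
  rw [Algebra.algebraMap_eq_smul_one, map_smul]
  have : D 1 = 0 := by linarith
  simp [this]

/-- A point derivation is the sum of its values on coordinates times partial derivatives. -/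
theorem derivation_eq_sum [T2Space S] [IsManifold (𝓡 n) ∞ S]
    (hD : ∀ a b, D (a * b) = a p * D b + b p * D a)
    {ψ : OpenPartialHomeomorph S (EuclideanSpace ℝ (Fin n))}
    (hψ : ψ ∈ IsManifold.maximalAtlas (𝓡 n) ∞ S) (hp : p ∈ ψ.source) (F : C^∞⟮𝓡 n, S; ℝ⟯) :
    D F = ∑ a, chartPd ψ a F p * D (globalize p fun q => ψ q a) := by
  have hFs : ContDiffOn ℝ ∞ (fun v => F (ψ.symm v)) ψ.target := by
    refine ContMDiffOn.contDiffOn ?_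
    exact F.contMDiff.comp_contMDiffOn (contMDiffOn_symm_of_mem_maximalAtlas hψ)
  have hcoord : ∀ a, (globalize (n := n) p (fun q => ψ q a) : S → ℝ) =ᶠ[𝓝 p] fun q => ψ q a :=
    fun a => globalize_eventuallyEq (eventually_contMDiffAt_of_contDiffOn hψ hp isOpen_univ
      (Set.mem_univ _) (EuclideanSpace.proj (𝕜 := ℝ) a).contDiff.contDiffOn)
  -- Hadamard's lemma needs a function on all of `ℝ^n`; only the germ of `F ∘ ψ⁻¹` at `ψ p` matters.
  obtain ⟨h, hh⟩ := exists_contMDiffMap_eventuallyEq (n := n) (S := EuclideanSpace ℝ (Fin n))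
    (p := ψ p) (h := fun v => F (ψ.symm v)) (by
      filter_upwards [ψ.open_target.mem_nhds (ψ.map_source hp)] with v hv
      exact (hFs.contDiffAt (ψ.open_target.mem_nhds hv)).contMDiffAt)
  obtain ⟨g, hg, hgp, hgh⟩ := hadamard h.contMDiff.contDiff (ψ p)
  have hgs : ∀ a, (globalize (n := n) p (fun q => g a (ψ q)) : S → ℝ) =ᶠ[𝓝 p]
      fun q => g a (ψ q) := fun a =>
    globalize_eventuallyEq (eventually_contMDiffAt_of_contDiffOn hψ hp isOpen_univ
      (Set.mem_univ _) (hg a).contDiffOn)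
  -- The first order expansion at `p`, written with global functions so that `D` applies. The
  -- factors `u^a - u^a(p)` vanish at `p`, so only `g_a(p) D(u^a)` survives.
  have hF : (F : S → ℝ) =ᶠ[𝓝 p] ((algebraMap ℝ C^∞⟮𝓡 n, S; ℝ⟯ (h (ψ p)) +
      ∑ a, (globalize p (fun q => ψ q a) - algebraMap ℝ C^∞⟮𝓡 n, S; ℝ⟯ (ψ p a)) *
        globalize p (fun q => g a (ψ q)) : C^∞⟮𝓡 n, S; ℝ⟯) : S → ℝ) := by
    filter_upwards [ψ.open_source.mem_nhds hp, (ψ.continuousAt hp).eventually hh,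
      Filter.eventually_all.2 hcoord, Filter.eventually_all.2 hgs] with q hq h1 h2 h3
    have hsum : ∀ A : Fin n → C^∞⟮𝓡 n, S; ℝ⟯, (∑ a, A a) q = ∑ a, A a q := fun A =>
      map_sum (ContMDiffMap.evalRingHom q : C^∞⟮𝓡 n, S; ℝ⟯ →+* ℝ) A Finset.univ
    rw [ψ.left_inv hq] at h1
    rw [← h1, hgh, ContMDiffMap.coe_add, Pi.add_apply, hsum]
    simp only [ContMDiffMap.coe_mul, ContMDiffMap.coe_sub, Pi.mul_apply, Pi.sub_apply, h2, h3]
    rfl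
  have hpd : ∀ a, chartPd ψ a F p = g a (ψ p) := fun a => by
    rw [hgp]; exact (pd_congr a hh).symm
  rw [derivation_congr D hD hF, map_add, derivation_const D hD, zero_add, map_sum]
  refine Finset.sum_congr rfl fun a _ => ?_
  have h1 : (globalize (n := n) p (fun q => ψ q a) - algebraMap ℝ C^∞⟮𝓡 n, S; ℝ⟯ (ψ p a) :
      C^∞⟮𝓡 n, S; ℝ⟯) p = 0 := by
    rw [ContMDiffMap.coe_sub, Pi.sub_apply, (hcoord a).self_of_nhds]
    exact sub_self _
  rw [hD, h1, (hgs a).self_of_nhds, map_sub, derivation_const D hD, hpd]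
  ring

variable {m : ℕ} {M : Type*} [TopologicalSpace M]

/-- `{h, x^I} = ∂_a h {u^a, x^I}`. -/
theorem bracketCoord_eq_sum [T2Space S] [IsManifold (𝓡 n) ∞ S] (br : Bracket n N S) (f : S → M)
    (φ : OpenPartialHomeomorph M (EuclideanSpace ℝ (Fin m)))
    {ψ : OpenPartialHomeomorph S (EuclideanSpace ℝ (Fin n))}
    (hψ : ψ ∈ IsManifold.maximalAtlas (𝓡 n) ∞ S) (hp : p ∈ ψ.source) (I : Fin N → Fin m)
    {h : S → ℝ} (hh : ∀ᶠ q in 𝓝 p, ContMDiffAt (𝓡 n) 𝓘(ℝ) ∞ h q) :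
    bracketCoord br f φ h I p =
      ∑ a, chartPd ψ a h p * bracketCoord br f φ (fun q => ψ q a) I p := by
  let m₀ : Fin (N + 1) → C^∞⟮𝓡 n, S; ℝ⟯ := fun k =>
    globalize p ((Fin.cons 0 fun r => embCoord f φ (I r) : Fin (N + 1) → S → ℝ) k)
  let D : C^∞⟮𝓡 n, S; ℝ⟯ →ₗ[ℝ] ℝ :=
    { toFun := fun a => br.toMultilinearMap (Function.update m₀ 0 a) p
      map_add' := fun a b => by rw [MultilinearMap.map_update_add]; rfl
      map_smul' := fun r a => by rw [MultilinearMap.map_update_smul]; rfl }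
  have hD : ∀ a b, D (a * b) = a p * D b + b p * D a := fun a b => by
    change br.toMultilinearMap (Function.update m₀ 0 (a * b)) p = _
    rw [br.leibniz]
    rfl
  have hbr : ∀ k : S → ℝ, bracketCoord br f φ k I p = D (globalize p k) := by
    intro k
    change br.toMultilinearMap _ p = br.toMultilinearMap (Function.update m₀ 0 (globalize p k)) p
    congr 2
    ext1 j
    refine Fin.cases ?_ (fun j => ?_) j
    · simp
    · simp [m₀]
  simp only [hbr]
  rw [derivation_eq_sum D hD hψ hp]
  exact Finset.sum_congr rfl fun a _ => by
    rw [chartPd_congr hp (globalize_eventuallyEq hh)]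

end Derivations

/-! ### Metrics and immersions in charts -/

section Charts

open Matrix

variable {d : ℕ} {M : Type*} [TopologicalSpace M] [ChartedSpace (EuclideanSpace ℝ (Fin d)) M]

theorem mdifferentiable_of_mem_maximalAtlas [IsManifold (𝓡 d) ∞ M]
    {φ : OpenPartialHomeomorph M (EuclideanSpace ℝ (Fin d))}
    (hφ : φ ∈ IsManifold.maximalAtlas (𝓡 d) ∞ M) : φ.MDifferentiable (𝓡 d) (𝓡 d) :=
  ⟨(contMDiffOn_of_mem_maximalAtlas hφ).mdifferentiableOn (by simp),
    (contMDiffOn_symm_of_mem_maximalAtlas hφ).mdifferentiableOn (by simp)⟩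

/-- The metric in terms of its components. -/
theorem metric_mfderiv_symm (h : BilinField d M)
    (φ : OpenPartialHomeomorph M (EuclideanSpace ℝ (Fin d))) {y : EuclideanSpace ℝ (Fin d)} {x : M}
    (hx : φ.symm y = x) (v w : EuclideanSpace ℝ (Fin d)) :
    h x (mfderiv (𝓡 d) (𝓡 d) φ.symm y v) (mfderiv (𝓡 d) (𝓡 d) φ.symm y w) =
      ∑ i, ∑ j, v i * metricComp h φ y i j * w j := by
  subst hx
  let A : EuclideanSpace ℝ (Fin d) →ₗ[ℝ] TangentSpace (𝓡 d) (φ.symm y) :=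
    (mfderiv (𝓡 d) (𝓡 d) φ.symm y).toLinearMap
  let B : LinearMap.BilinForm ℝ (EuclideanSpace ℝ (Fin d)) := (h (φ.symm y)).compl₁₂ A A
  change B v w = ∑ i, ∑ j, v i * B (EuclideanSpace.single i 1) (EuclideanSpace.single j 1) * w j
  conv_lhs => rw [eq_sum_single v, eq_sum_single w]
  simp only [map_sum, LinearMap.sum_apply, map_smul, LinearMap.smul_apply, smul_eq_mul,
    Finset.mul_sum]
  rw [Finset.sum_comm]
  exact Finset.sum_congr rfl fun i _ => Finset.sum_congr rfl fun j _ => by ring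

theorem metricComp_transpose {h : BilinField d M}
    (hs : ∀ (x : M) (X Y : TangentSpace (𝓡 d) x), h x X Y = h x Y X)
    (φ : OpenPartialHomeomorph M (EuclideanSpace ℝ (Fin d))) (y : EuclideanSpace ℝ (Fin d)) :
    (metricComp h φ y)ᵀ = metricComp h φ y := by
  ext i j
  exact hs _ _ _

/-- A kernel vector of the component matrix would give a tangent vector orthogonal to all others,
because the differential of the inverse chart is bijective. -/
theorem metricComp_det_ne_zero [IsManifold (𝓡 d) ∞ M] {h : BilinField d M}
    (hn : ∀ x : M, (h x).Nondegenerate)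
    {φ : OpenPartialHomeomorph M (EuclideanSpace ℝ (Fin d))}
    (hφ : φ ∈ IsManifold.maximalAtlas (𝓡 d) ∞ M) {y : EuclideanSpace ℝ (Fin d)}
    (hy : y ∈ φ.target) : (metricComp h φ y).det ≠ 0 := by
  intro h0
  obtain ⟨v, hv, hv0⟩ := Matrix.exists_mulVec_eq_zero_iff.2 h0
  have hbij := (mdifferentiable_of_mem_maximalAtlas hφ).symm.mfderiv_bijective (x := y) hy
  have hz : mfderiv (𝓡 d) (𝓡 d) φ.symm y (WithLp.toLp 2 v : EuclideanSpace ℝ (Fin d)) = 0 := by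
    refine (hn (φ.symm y)).2 _ fun X => ?_
    obtain ⟨w, rfl⟩ := hbij.2 X
    refine (metric_mfderiv_symm h φ rfl w (WithLp.toLp 2 v)).trans ?_
    refine Finset.sum_eq_zero fun i _ => ?_
    have := congrFun hv0 i
    simp only [Matrix.mulVec, dotProduct, Pi.zero_apply] at this
    simp only [mul_assoc]
    rw [← Finset.mul_sum, this, mul_zero]
  have := hbij.1 (hz.trans (map_zero _).symm)
  exact hv (congrArg (WithLp.ofLp (p := 2)) this)

end Charts

/-! ### Immersions in charts -/

section Immersion

open Matrix

variable {m n : ℕ} {M : Type*} [TopologicalSpace M] [ChartedSpace (EuclideanSpace ℝ (Fin m)) M]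
  {S : Type*} [TopologicalSpace S] [ChartedSpace (EuclideanSpace ℝ (Fin n)) S]

/-- A map in charts. -/
def inCharts (f : S → M) (φ : OpenPartialHomeomorph M (EuclideanSpace ℝ (Fin m)))
    (ψ : OpenPartialHomeomorph S (EuclideanSpace ℝ (Fin n))) (v : EuclideanSpace ℝ (Fin n)) :
    EuclideanSpace ℝ (Fin m) :=
  φ (f (ψ.symm v))

/-- The common domain of the coordinates. -/
def commonDomain (f : S → M) (φ : OpenPartialHomeomorph M (EuclideanSpace ℝ (Fin m)))
    (ψ : OpenPartialHomeomorph S (EuclideanSpace ℝ (Fin n))) : Set (EuclideanSpace ℝ (Fin n)) :=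
  ψ.target ∩ ψ.symm ⁻¹' (f ⁻¹' φ.source)

variable {f : S → M} {φ : OpenPartialHomeomorph M (EuclideanSpace ℝ (Fin m))}
  {ψ : OpenPartialHomeomorph S (EuclideanSpace ℝ (Fin n))}

theorem isOpen_commonDomain (hf : ContMDiff (𝓡 n) (𝓡 m) ∞ f) :
    IsOpen (commonDomain f φ ψ) :=
  ψ.symm.isOpen_inter_preimage (φ.open_source.preimage hf.continuous)

theorem contDiffOn_inCharts (hf : ContMDiff (𝓡 n) (𝓡 m) ∞ f)
    (hφ : φ ∈ IsManifold.maximalAtlas (𝓡 m) ∞ M)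
    (hψ : ψ ∈ IsManifold.maximalAtlas (𝓡 n) ∞ S) :
    ContDiffOn ℝ ∞ (inCharts f φ ψ) (commonDomain f φ ψ) := by
  refine ContMDiffOn.contDiffOn ?_
  exact (contMDiffOn_of_mem_maximalAtlas hφ).comp (hf.comp_contMDiffOn
    ((contMDiffOn_symm_of_mem_maximalAtlas hψ).mono Set.inter_subset_left)) fun v hv => hv.2

variable [IsManifold (𝓡 m) ∞ M] [IsManifold (𝓡 n) ∞ S]

/-- The chain rule applied to both sides of `f ∘ ψ⁻¹ = φ⁻¹ ∘ F`, with `F` the map in charts. -/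
theorem mfderiv_comp_symm (hf : ContMDiff (𝓡 n) (𝓡 m) ∞ f)
    (hφ : φ ∈ IsManifold.maximalAtlas (𝓡 m) ∞ M)
    (hψ : ψ ∈ IsManifold.maximalAtlas (𝓡 n) ∞ S)
    {v : EuclideanSpace ℝ (Fin n)} (hv : v ∈ commonDomain f φ ψ)
    (w : EuclideanSpace ℝ (Fin n)) :
    (mfderiv (𝓡 n) (𝓡 m) f (ψ.symm v) (mfderiv (𝓡 n) (𝓡 n) ψ.symm v w) :
      EuclideanSpace ℝ (Fin m)) =
    mfderiv (𝓡 m) (𝓡 m) φ.symm (inCharts f φ ψ v) (fderiv ℝ (inCharts f φ ψ) v w) := by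
  have hO := isOpen_commonDomain (φ := φ) (ψ := ψ) hf
  have hF : MDifferentiableAt (𝓡 n) (𝓡 m) (inCharts f φ ψ) v :=
    (((contDiffOn_inCharts hf hφ hψ).contDiffAt (hO.mem_nhds hv)).differentiableAt
      (by simp)).mdifferentiableAt
  have hψs := (mdifferentiable_of_mem_maximalAtlas hψ).mdifferentiableAt_symm hv.1
  have hφs := (mdifferentiable_of_mem_maximalAtlas hφ).mdifferentiableAt_symm
    (x := inCharts f φ ψ v) (φ.map_source hv.2)
  have hfd : MDifferentiableAt (𝓡 n) (𝓡 m) f (ψ.symm v) := hf.mdifferentiable (by simp) _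
  have e : (f ∘ ψ.symm) =ᶠ[𝓝 v] (φ.symm ∘ inCharts f φ ψ) := by
    filter_upwards [hO.mem_nhds hv] with x hx
    exact (φ.left_inv hx.2).symm
  have h1 := mfderiv_comp v hfd hψs
  have h2 := mfderiv_comp v hφs hF
  have h3 := e.mfderiv_eq (I := 𝓡 n) (I' := 𝓡 m)
  -- The two base points agree only propositionally; viewing the values in the model space avoids
  -- transport between tangent spaces.
  have h4 : ∀ w : EuclideanSpace ℝ (Fin n),
      (mfderiv (𝓡 n) (𝓡 m) (f ∘ ψ.symm) v w : EuclideanSpace ℝ (Fin m)) =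
      mfderiv (𝓡 n) (𝓡 m) (φ.symm ∘ inCharts f φ ψ) v w := fun w => congrArg (fun A => A w) h3
  have h5 := h4 w
  rw [h1, h2] at h5
  rw [← mfderiv_eq_fderiv]
  exact h5

theorem vecComp_mfderiv (hf : ContMDiff (𝓡 n) (𝓡 m) ∞ f)
    (hφ : φ ∈ IsManifold.maximalAtlas (𝓡 m) ∞ M)
    (hψ : ψ ∈ IsManifold.maximalAtlas (𝓡 n) ∞ S)
    {p : S} (hp : p ∈ ψ.source) (hpf : f p ∈ φ.source)
    (X : TangentSpace (𝓡 n) p) (i : Fin m) :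
    vecComp φ (mfderiv (𝓡 n) (𝓡 m) f p X) i =
      ∑ a, jac (inCharts f φ ψ) (ψ p) i a * vecComp ψ X a := by
  have hv : ψ p ∈ commonDomain f φ ψ :=
    ⟨ψ.map_source hp, by rw [Set.mem_preimage, ψ.left_inv hp]; exact hpf⟩
  have hO := isOpen_commonDomain (φ := φ) (ψ := ψ) hf
  have hFd := ((contDiffOn_inCharts hf hφ hψ).contDiffAt (hO.mem_nhds hv)).differentiableAt
    (by simp)
  have hF : MDifferentiableAt (𝓡 n) (𝓡 m) (inCharts f φ ψ) (ψ p) := hFd.mdifferentiableAt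
  have hψs := (mdifferentiable_of_mem_maximalAtlas hψ).mdifferentiableAt hp
  have hφs := (mdifferentiable_of_mem_maximalAtlas hφ).mdifferentiableAt hpf
  have hfd : MDifferentiableAt (𝓡 n) (𝓡 m) f p := hf.mdifferentiable (by simp) _
  have e : (φ ∘ f) =ᶠ[𝓝 p] (inCharts f φ ψ ∘ ψ) := by
    filter_upwards [ψ.open_source.mem_nhds hp] with x hx
    simp [inCharts, ψ.left_inv hx]
  have h3 := e.mfderiv_eq (I := 𝓡 n) (I' := 𝓡 m)
  have h4 : (mfderiv (𝓡 n) (𝓡 m) (φ ∘ f) p X : EuclideanSpace ℝ (Fin m)) =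
      mfderiv (𝓡 n) (𝓡 m) (inCharts f φ ψ ∘ ψ) p X := congrArg (fun A => A X) h3
  rw [mfderiv_comp p hφs hfd, mfderiv_comp p hF hψs] at h4
  have h5 : vecComp φ (mfderiv (𝓡 n) (𝓡 m) f p X) =
      fderiv ℝ (inCharts f φ ψ) (ψ p) (vecComp ψ X) := by
    rw [← mfderiv_eq_fderiv]; exact h4
  rw [h5, fderiv_apply_apply hFd]
  conv_lhs => rw [eq_sum_single (vecComp ψ X)]
  simp only [map_sum, map_smul, smul_eq_mul]
  exact Finset.sum_congr rfl fun a _ => mul_comm _ _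

/-- An isometric immersion is isometric in charts. -/
theorem isIsometricOn (hf : ContMDiff (𝓡 n) (𝓡 m) ∞ f)
    (hφ : φ ∈ IsManifold.maximalAtlas (𝓡 m) ∞ M)
    (hψ : ψ ∈ IsManifold.maximalAtlas (𝓡 n) ∞ S)
    {η : BilinField m M} (hη : IsPseudoRiemannian η)
    (hg : ∀ q : S, (inducedMetric (n := n) η f q).Nondegenerate) :
    IsIsometricOn (commonDomain f φ ψ) φ.target (inCharts f φ ψ)
      (metricComp (inducedMetric η f) ψ) (metricComp η φ) where
  isOpen_source := isOpen_commonDomain hf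
  isOpen_target := φ.open_target
  contDiffOn := contDiffOn_inCharts hf hφ hψ
  mapsTo := fun _ hv => φ.map_source hv.2
  smooth := hη.smooth φ hφ
  symm_target := metricComp_transpose hη.symm φ
  symm_source := metricComp_transpose (h := inducedMetric η f) (fun _ _ _ => hη.symm _ _ _) ψ
  det_target := fun _ hv => metricComp_det_ne_zero hη.nondegenerate hφ hv
  det_source := fun _ hv => metricComp_det_ne_zero hg hψ hv.1
  metric_eq := fun v hv => by
    ext a b
    have hFd := ((contDiffOn_inCharts hf hφ hψ).contDiffAt
      ((isOpen_commonDomain hf).mem_nhds hv)).differentiableAt (by simp)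
    have h1 : metricComp (inducedMetric η f) ψ v a b = η (f (ψ.symm v))
        (mfderiv (𝓡 m) (𝓡 m) φ.symm (inCharts f φ ψ v)
          (fderiv ℝ (inCharts f φ ψ) v (EuclideanSpace.single a 1)))
        (mfderiv (𝓡 m) (𝓡 m) φ.symm (inCharts f φ ψ v)
          (fderiv ℝ (inCharts f φ ψ) v (EuclideanSpace.single b 1))) :=
      congrArg₂ (fun X Y : EuclideanSpace ℝ (Fin m) => η (f (ψ.symm v)) X Y)
        (mfderiv_comp_symm hf hφ hψ hv _) (mfderiv_comp_symm hf hφ hψ hv _)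
    rw [h1]
    refine (metric_mfderiv_symm η φ (φ.left_inv hv.2) _ _).trans ?_
    rw [sum_mul_mul_apply]
    simp only [fderiv_apply_apply hFd]
    exact Finset.sum_congr rfl fun i _ => Finset.sum_congr rfl fun j _ => by
      rw [mul_comm (fderiv _ _ _ _)]; rfl

end Immersion

/-! ### Brackets compatible with the induced metric -/

section CommonDomain

variable {m n : ℕ} {M : Type*} [TopologicalSpace M] {S : Type*} [TopologicalSpace S] {f : S → M}
  {φ : OpenPartialHomeomorph M (EuclideanSpace ℝ (Fin m))}
  {ψ : OpenPartialHomeomorph S (EuclideanSpace ℝ (Fin n))} {p : S}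

theorem inCharts_apply (hp : p ∈ ψ.source) : inCharts f φ ψ (ψ p) = φ (f p) := by
  rw [inCharts, ψ.left_inv hp]

theorem mem_commonDomain (hp : p ∈ ψ.source) (hpf : f p ∈ φ.source) :
    ψ p ∈ commonDomain f φ ψ :=
  ⟨ψ.map_source hp, by rw [Set.mem_preimage, ψ.left_inv hp]; exact hpf⟩

end CommonDomain

section Compatible

open Matrix

variable {m n N : ℕ} {M : Type*} [TopologicalSpace M] [ChartedSpace (EuclideanSpace ℝ (Fin m)) M]
  {S : Type*} [TopologicalSpace S] [ChartedSpace (EuclideanSpace ℝ (Fin n)) S]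
  {η : BilinField m M} {f : S → M} {br : Bracket n N S} {ε : ℝ} {γ : S → ℝ}
  {φ : OpenPartialHomeomorph M (EuclideanSpace ℝ (Fin m))}
  {ψ : OpenPartialHomeomorph S (EuclideanSpace ℝ (Fin n))} {p : S}

theorem gradInner_embCoord (η : BilinField m M) (f : S → M)
    (φ : OpenPartialHomeomorph M (EuclideanSpace ℝ (Fin m)))
    (ψ : OpenPartialHomeomorph S (EuclideanSpace ℝ (Fin n))) (i j : Fin m) (q : S) :
    gradInner η f ψ (embCoord f φ i) (embCoord f φ j) q =
      (jac (inCharts f φ ψ) (ψ q) * ((metricComp (inducedMetric η f) ψ (ψ q))⁻¹ *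
        (jac (inCharts f φ ψ) (ψ q))ᵀ)) i j := by
  have := sum_mul_mul_apply (jac (inCharts f φ ψ) (ψ q))ᵀ
    (metricComp (inducedMetric η f) ψ (ψ q))⁻¹ (jac (inCharts f φ ψ) (ψ q))ᵀ i j
  rw [Matrix.transpose_transpose] at this
  rw [this]
  rfl

/-- Compatibility together with `ε² = 1`. -/
theorem DD_eq_gradInner (hε : ε = 1 ∨ ε = -1) (hγ : 0 < γ p) (hbr : IsCompatible η f br ε γ φ ψ)
    (hp : p ∈ ψ.source) (hpf : f p ∈ φ.source) (i j : Fin m) :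
    DD η f br ε γ φ i j p = gradInner η f ψ (embCoord f φ i) (embCoord f φ j) p := by
  have h2 : ε * ε = 1 := by rcases hε with rfl | rfl <;> norm_num
  rw [DD, hbr p hp hpf]
  have := hγ.ne'
  field_simp
  rw [pow_two, h2, one_mul]

theorem eventually_mem_domain [IsManifold (𝓡 n) ∞ S] (hf : ContMDiff (𝓡 n) (𝓡 m) ∞ f)
    (hp : p ∈ ψ.source) (hpf : f p ∈ φ.source) :
    ∀ᶠ q in 𝓝 p, q ∈ ψ.source ∧ f q ∈ φ.source :=
  (ψ.open_source.eventually_mem hp).and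
    ((φ.open_source.preimage hf.continuous).eventually_mem hpf)

/-- Functions which are smooth in the chart `ψ` are smooth. -/
theorem eventually_contMDiffAt_of_eq [IsManifold (𝓡 n) ∞ S] (hf : ContMDiff (𝓡 n) (𝓡 m) ∞ f)
    (hψ : ψ ∈ IsManifold.maximalAtlas (𝓡 n) ∞ S) (hp : p ∈ ψ.source) (hpf : f p ∈ φ.source)
    {h : S → ℝ} {g : EuclideanSpace ℝ (Fin n) → ℝ}
    (hg : ContDiffOn ℝ ∞ g (commonDomain f φ ψ))
    (e : ∀ q ∈ ψ.source, f q ∈ φ.source → h q = g (ψ q)) :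
    ∀ᶠ q in 𝓝 p, ContMDiffAt (𝓡 n) 𝓘(ℝ) ∞ h q := by
  have e' : h =ᶠ[𝓝 p] fun q => g (ψ q) :=
    (eventually_mem_domain hf hp hpf).mono fun q hq => e q hq.1 hq.2
  filter_upwards [eventually_contMDiffAt_of_contDiffOn hψ hp (isOpen_commonDomain hf)
    (mem_commonDomain hp hpf) hg, e'.eventuallyEq_nhds] with q h1 h2
  exact h1.congr_of_eventuallyEq h2

theorem chartPd_of_eq [IsManifold (𝓡 n) ∞ S] (hf : ContMDiff (𝓡 n) (𝓡 m) ∞ f)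
    (hp : p ∈ ψ.source) (hpf : f p ∈ φ.source)
    {h : S → ℝ} {g : EuclideanSpace ℝ (Fin n) → ℝ}
    (e : ∀ q ∈ ψ.source, f q ∈ φ.source → h q = g (ψ q)) (a : Fin n) :
    chartPd ψ a h p = pd a g (ψ p) := by
  refine pd_congr a ?_
  filter_upwards [(isOpen_commonDomain hf).mem_nhds (mem_commonDomain hp hpf)] with v hv
  rw [e _ (ψ.map_target hv.1) hv.2, ψ.right_inv hv.1]

theorem sum_bilinear {ι : Type*} [Fintype ι] (B : Fin n → ι → ℝ) (c : ι → ι → ℝ)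
    (x y : Fin n → ℝ) :
    ∑ I, ∑ J, (∑ a, x a * B a I) * (∑ b, y b * B b J) * c I J =
      ∑ a, ∑ b, (∑ I, ∑ J, B a I * B b J * c I J) * x a * y b := by
  have h1 : ∀ I J, (∑ a, x a * B a I) * (∑ b, y b * B b J) * c I J =
      ∑ a, ∑ b, B a I * B b J * c I J * x a * y b := by
    intro I J
    rw [Finset.sum_mul_sum, Finset.sum_mul]
    refine Finset.sum_congr rfl fun a _ => ?_
    rw [Finset.sum_mul]
    exact Finset.sum_congr rfl fun b _ => by ring
  simp only [h1]
  simp only [Finset.sum_mul]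
  rw [Finset.sum_congr rfl fun I _ => Finset.sum_comm, Finset.sum_comm]
  refine Finset.sum_congr rfl fun a _ => ?_
  rw [Finset.sum_congr rfl fun I _ => Finset.sum_comm, Finset.sum_comm]

theorem eventually_contMDiffAt_embCoord [IsManifold (𝓡 n) ∞ S]
    (hf : ContMDiff (𝓡 n) (𝓡 m) ∞ f)
    (hφ : φ ∈ IsManifold.maximalAtlas (𝓡 m) ∞ M) (hψ : ψ ∈ IsManifold.maximalAtlas (𝓡 n) ∞ S)
    (hp : p ∈ ψ.source) (hpf : f p ∈ φ.source) (i : Fin m) :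
    ∀ᶠ q in 𝓝 p, ContMDiffAt (𝓡 n) 𝓘(ℝ) ∞ (embCoord f φ i) q :=
  eventually_contMDiffAt_of_eq hf hψ hp hpf (g := fun v => inCharts f φ ψ v i)
    ((EuclideanSpace.proj (𝕜 := ℝ) i).contDiff.comp_contDiffOn (contDiffOn_inCharts hf hφ hψ))
    fun q hq _ => by rw [inCharts_apply hq, embCoord]

variable [IsManifold (𝓡 m) ∞ M] [T2Space S] [IsManifold (𝓡 n) ∞ S]

/-- The bracket of the coordinates of `ψ` with the embedding coordinates determines the inverse of
the induced metric. -/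
theorem bracket_metric (hη : IsPseudoRiemannian η) (hf : ContMDiff (𝓡 n) (𝓡 m) ∞ f)
    (hg : ∀ q : S, (inducedMetric (n := n) η f q).Nondegenerate)
    (hφ : φ ∈ IsManifold.maximalAtlas (𝓡 m) ∞ M) (hψ : ψ ∈ IsManifold.maximalAtlas (𝓡 n) ∞ S)
    (hbr : IsCompatible η f br ε γ φ ψ) (hp : p ∈ ψ.source) (hpf : f p ∈ φ.source) (a b : Fin n) :
    ∑ I : Fin N → Fin m, ∑ J : Fin N → Fin m, bracketCoord br f φ (fun q => ψ q a) I p *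
        bracketCoord br f φ (fun q => ψ q b) J p * etaMulti η f φ I J p =
      N.factorial * (ε * γ p ^ 2) * (metricComp (inducedMetric η f) ψ (ψ p))⁻¹ a b := by
  have hi := isIsometricOn hf hφ hψ hη hg
  have hu := mem_commonDomain hp hpf
  set B : Fin n → (Fin N → Fin m) → ℝ := fun a I => bracketCoord br f φ (fun q => ψ q a) I p
  set E := jac (inCharts f φ ψ) (ψ p) with hE
  set Gi := (metricComp (inducedMetric η f) ψ (ψ p))⁻¹ with hGi
  let C : Matrix (Fin n) (Fin n) ℝ :=
    Matrix.of fun a b => ∑ I, ∑ J, B a I * B b J * etaMulti η f φ I J p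
  have hx : ∀ i I, bracketCoord br f φ (embCoord f φ i) I p = ∑ a, E i a * B a I := fun i I =>
    bracketCoord_eq_sum br f φ hψ hp I (eventually_contMDiffAt_embCoord hf hφ hψ hp hpf i)
  have hN : (0 : ℝ) < N.factorial := by exact_mod_cast N.factorial_pos
  have hsq : (1 / √(N.factorial : ℝ)) * (1 / √(N.factorial : ℝ)) = 1 / N.factorial := by
    rw [div_mul_div_comm, Real.mul_self_sqrt hN.le, one_mul]
  -- Compatibility in matrix form; `N!` undoes the two factors `1 / √N!`.
  have h1 : E * (C * Eᵀ) = (N.factorial * (ε * γ p ^ 2)) • (E * (Gi * Eᵀ)) := by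
    ext i j
    have h2 := hbr p hp hpf i j
    rw [gradInner_embCoord] at h2
    have h3 : ∀ I J, PP br f φ i I p * PP br f φ j J p * etaMulti η f φ I J p =
        1 / N.factorial * ((∑ a, E i a * B a I) * (∑ b, E j b * B b J) * etaMulti η f φ I J p) :=
      fun I J => by rw [PP, PP, hx, hx, ← hsq]; ring
    simp only [h3, ← Finset.mul_sum] at h2
    rw [sum_bilinear] at h2
    have h4 := sum_mul_mul_apply Eᵀ C Eᵀ i j
    rw [Matrix.transpose_transpose] at h4
    rw [h4, Matrix.smul_apply, smul_eq_mul, mul_assoc, ← h2, ← mul_assoc,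
      mul_one_div_cancel hN.ne', one_mul]
    rfl
  have hL := hi.coframe_transpose_mul hu
  have hL' := hi.transpose_mul_coframe hu
  -- The frame can be stripped off both sides since `Lᵀ E = 1 = Eᵀ L`.
  have h5 : ∀ X : Matrix (Fin n) (Fin n) ℝ,
      (coframe E (metricComp η φ (inCharts f φ ψ (ψ p))) Gi)ᵀ * (E * (X * Eᵀ)) *
        coframe E (metricComp η φ (inCharts f φ ψ (ψ p))) Gi = X := by
    intro X
    rw [← Matrix.mul_assoc _ E, hL, Matrix.one_mul, Matrix.mul_assoc, hL', Matrix.mul_one]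
  have h6 := h5 C
  rw [h1, Matrix.mul_smul, Matrix.smul_mul, h5] at h6
  exact (congrFun (congrFun h6 a) b).symm

/-- `𝒟^i(h) = g^{ab} (∂_a x^i) (∂_b h)`. -/
theorem DOpUp_eq_gradInner (hη : IsPseudoRiemannian η) (hf : ContMDiff (𝓡 n) (𝓡 m) ∞ f)
    (hg : ∀ q : S, (inducedMetric (n := n) η f q).Nondegenerate) (hε : ε = 1 ∨ ε = -1)
    (hγ : 0 < γ p)
    (hφ : φ ∈ IsManifold.maximalAtlas (𝓡 m) ∞ M) (hψ : ψ ∈ IsManifold.maximalAtlas (𝓡 n) ∞ S)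
    (hbr : IsCompatible η f br ε γ φ ψ) (hp : p ∈ ψ.source) (hpf : f p ∈ φ.source)
    (i : Fin m) {h : S → ℝ} (hh : ∀ᶠ q in 𝓝 p, ContMDiffAt (𝓡 n) 𝓘(ℝ) ∞ h q) :
    DOpUp η f br ε γ φ i h p = gradInner η f ψ (embCoord f φ i) h p := by
  have h2 : ε * ε = 1 := by rcases hε with rfl | rfl <;> norm_num
  have hN : (N.factorial : ℝ) ≠ 0 := by exact_mod_cast N.factorial_ne_zero
  simp only [DOpUp, bracketCoord_eq_sum br f φ hψ hp _ hh, bracketCoord_eq_sum br f φ hψ hp _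
    (eventually_contMDiffAt_embCoord hf hφ hψ hp hpf i)]
  rw [sum_bilinear]
  simp only [bracket_metric hη hf hg hφ hψ hbr hp hpf, gradInner, Finset.mul_sum]
  refine Finset.sum_congr rfl fun a _ => Finset.sum_congr rfl fun b _ => ?_
  have := hγ.ne'
  field_simp
  rw [pow_two, h2, one_mul]

variable (hη : IsPseudoRiemannian η) (hf : ContMDiff (𝓡 n) (𝓡 m) ∞ f)
  (hg : ∀ q : S, (inducedMetric (n := n) η f q).Nondegenerate) (hε : ε = 1 ∨ ε = -1)
  (hγ : ∀ q, 0 < γ q)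
  (hφ : φ ∈ IsManifold.maximalAtlas (𝓡 m) ∞ M) (hψ : ψ ∈ IsManifold.maximalAtlas (𝓡 n) ∞ S)
  (hbr : IsCompatible η f br ε γ φ ψ) (hp : p ∈ ψ.source) (hpf : f p ∈ φ.source)

omit [IsManifold (𝓡 m) ∞ M] [T2Space S] [IsManifold (𝓡 n) ∞ S] in
include hε hγ hbr hp hpf in
theorem DD_eq (i j : Fin m) : DD η f br ε γ φ i j p =
    (jac (inCharts f φ ψ) (ψ p) * ((metricComp (inducedMetric η f) ψ (ψ p))⁻¹ *
        (jac (inCharts f φ ψ) (ψ p))ᵀ)) i j := by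
  rw [DD_eq_gradInner hε (hγ p) hbr hp hpf, gradInner_embCoord]

omit [IsManifold (𝓡 m) ∞ M] [T2Space S] [IsManifold (𝓡 n) ∞ S] in
include hε hγ hbr hp hpf in
theorem DMixed_eq (k l : Fin m) : DMixed η f br ε γ φ k l p =
    ∑ b, coframe (jac (inCharts f φ ψ) (ψ p)) (metricComp η φ (inCharts f φ ψ (ψ p)))
      (metricComp (inducedMetric η f) ψ (ψ p))⁻¹ k b * jac (inCharts f φ ψ) (ψ p) l b := by
  simp only [DMixed, DD_eq hε hγ hbr hp hpf, etaLow, ← inCharts_apply (f := f) (φ := φ) hp]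
  rw [← Matrix.mul_apply, ← Matrix.mul_assoc (jac _ _), ← Matrix.mul_assoc, ← coframe,
    Matrix.mul_apply]
  rfl

-- This says `𝒟_k = L_k^b ∂_b`, the form in which `nabla_up_apply` and `nabla_low_apply` turn `∇̂`
-- into a `liftDeriv`.
include hη hf hg hε hγ hφ hψ hbr hp hpf in
theorem DOp_eq (k : Fin m) {h : S → ℝ} (hh : ∀ᶠ q in 𝓝 p, ContMDiffAt (𝓡 n) 𝓘(ℝ) ∞ h q) :
    DOp η f br ε γ φ k h p = ∑ b, coframe (jac (inCharts f φ ψ) (ψ p))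
      (metricComp η φ (inCharts f φ ψ (ψ p))) (metricComp (inducedMetric η f) ψ (ψ p))⁻¹ k b *
        chartPd ψ b h p := by
  simp only [DOp, DOpUp_eq_gradInner hη hf hg hε (hγ p) hφ hψ hbr hp hpf _ hh, etaLow,
    ← inCharts_apply (f := f) (φ := φ) hp, gradInner, coframe, Matrix.mul_apply, Finset.mul_sum,
    Finset.sum_mul]
  rw [Finset.sum_congr rfl fun i _ => Finset.sum_comm, Finset.sum_comm]
  refine Finset.sum_congr rfl fun b _ => Finset.sum_congr rfl fun i _ =>
    Finset.sum_congr rfl fun a _ => ?_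
  change _ * (_ * jac (inCharts f φ ψ) (ψ p) i a * _) = _
  ring

omit [IsManifold (𝓡 m) ∞ M] [T2Space S] [IsManifold (𝓡 n) ∞ S] in
include hε hγ hbr hp hpf in
theorem PiUp_eq (i j : Fin m) : PiUp η f br ε γ φ i j p =
    ((metricComp η φ (inCharts f φ ψ (ψ p)))⁻¹ - jac (inCharts f φ ψ) (ψ p) *
      ((metricComp (inducedMetric η f) ψ (ψ p))⁻¹ * (jac (inCharts f φ ψ) (ψ p))ᵀ)) i j := by
  rw [PiUp, DD_eq hε hγ hbr hp hpf, etaUp, ← inCharts_apply (f := f) (φ := φ) hp,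
    Matrix.sub_apply]

omit [IsManifold (𝓡 m) ∞ M] [T2Space S] [IsManifold (𝓡 n) ∞ S] in
include hε hγ hbr hp hpf in
theorem PiLow_eq (i j : Fin m) : PiLow η f br ε γ φ i j p =
    (metricComp η φ (inCharts f φ ψ (ψ p)) - metricComp η φ (inCharts f φ ψ (ψ p)) *
      (jac (inCharts f φ ψ) (ψ p) * ((metricComp (inducedMetric η f) ψ (ψ p))⁻¹ *
        (jac (inCharts f φ ψ) (ψ p))ᵀ)) * metricComp η φ (inCharts f φ ψ (ψ p))) i j := by
  simp only [PiLow, DMixed_eq hε hγ hbr hp hpf, etaLow, ← inCharts_apply (f := f) (φ := φ) hp]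
  rw [Matrix.sub_apply, Matrix.mul_apply, ← Matrix.mul_assoc (jac _ _), ← Matrix.mul_assoc,
    ← coframe]
  simp only [Matrix.mul_apply (M := coframe _ _ _), Matrix.transpose_apply]

-- The bridge from brackets to matrices: `∇̂_k Π` is `L_k^b ∇̄_b Π`, evaluated by `nabla_normal_up`.
include hε hγ hbr hp hpf in
theorem dPiUp_eq (k i j : Fin m) : dPiUp η f br ε γ φ k i j p =
    liftDeriv (coframe (jac (inCharts f φ ψ) (ψ p)) (metricComp η φ (inCharts f φ ψ (ψ p)))
      (metricComp (inducedMetric η f) ψ (ψ p))⁻¹)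
      ((isIsometricOn hf hφ hψ hη hg).normalUp (ψ p)) k i j := by
  have hi := isIsometricOn hf hφ hψ hη hg
  have hu := mem_commonDomain hp hpf
  -- The identity is needed on the whole common domain, not just at `p`, because it is
  -- differentiated.
  have e := fun i j (q : S) (hq : q ∈ ψ.source) (hqf : f q ∈ φ.source) =>
    PiUp_eq (φ := φ) hε hγ hbr hq hqf i j
  have hsm := eventually_contMDiffAt_of_eq hf hψ hp hpf
    ((hi.smooth_inv_target.sub hi.smooth_proj) i j) (e i j)
  have hc : ∀ b, chartPd ψ b (PiUp η f br ε γ φ i j) p =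
      mpd b (fun v => (metricComp η φ (inCharts f φ ψ v))⁻¹ - jac (inCharts f φ ψ) v *
        ((metricComp (inducedMetric η f) ψ v)⁻¹ * (jac (inCharts f φ ψ) v)ᵀ)) (ψ p) i j := fun b =>
    chartPd_of_eq hf hp hpf (g := fun v => ((metricComp η φ (inCharts f φ ψ v))⁻¹ -
      jac (inCharts f φ ψ) v * ((metricComp (inducedMetric η f) ψ v)⁻¹ *
        (jac (inCharts f φ ψ) v)ᵀ)) i j) (e i j) b
  rw [dPiUp, nablaHatUp, DOp_eq hη hf hg hε hγ hφ hψ hbr hp hpf k hsm]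
  simp only [hc, PiUp_eq hε hγ hbr hp hpf, gammaBar,
    ← inCharts_apply (f := f) (φ := φ) hp, DMixed_eq hε hγ hbr hp hpf]
  refine (nabla_up_apply _ _ _ _ (fun b => mpd b (fun v => (metricComp η φ (inCharts f φ ψ v))⁻¹ -
    jac (inCharts f φ ψ) v * ((metricComp (inducedMetric η f) ψ v)⁻¹ *
      (jac (inCharts f φ ψ) v)ᵀ)) (ψ p)) _ k i j).trans ?_
  simp only [hi.nabla_normal_up hu]
  rfl

include hε hγ hbr hp hpf in
theorem dPiLow_eq (k i j : Fin m) : dPiLow η f br ε γ φ k i j p =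
    liftDeriv (coframe (jac (inCharts f φ ψ) (ψ p)) (metricComp η φ (inCharts f φ ψ (ψ p)))
      (metricComp (inducedMetric η f) ψ (ψ p))⁻¹)
      ((isIsometricOn hf hφ hψ hη hg).normalLow (ψ p)) k i j := by
  have hi := isIsometricOn hf hφ hψ hη hg
  have hu := mem_commonDomain hp hpf
  have hH := hi.smooth_comp hi.smooth
  have e := fun i j (q : S) (hq : q ∈ ψ.source) (hqf : f q ∈ φ.source) =>
    PiLow_eq (φ := φ) hε hγ hbr hq hqf i j
  have hsm := eventually_contMDiffAt_of_eq hf hψ hp hpf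
    ((hH.sub ((hH.mul hi.smooth_proj).mul hH)) i j) (e i j)
  have hc : ∀ b, chartPd ψ b (PiLow η f br ε γ φ i j) p =
      mpd b (fun v => metricComp η φ (inCharts f φ ψ v) -
        metricComp η φ (inCharts f φ ψ v) * (jac (inCharts f φ ψ) v *
          ((metricComp (inducedMetric η f) ψ v)⁻¹ * (jac (inCharts f φ ψ) v)ᵀ)) *
          metricComp η φ (inCharts f φ ψ v)) (ψ p) i j := fun b =>
    chartPd_of_eq hf hp hpf (g := fun v => (metricComp η φ (inCharts f φ ψ v) -
      metricComp η φ (inCharts f φ ψ v) * (jac (inCharts f φ ψ) v *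
        ((metricComp (inducedMetric η f) ψ v)⁻¹ * (jac (inCharts f φ ψ) v)ᵀ)) *
        metricComp η φ (inCharts f φ ψ v)) i j) (e i j) b
  rw [dPiLow, nablaHatLow, DOp_eq hη hf hg hε hγ hφ hψ hbr hp hpf k hsm]
  simp only [hc, PiLow_eq hε hγ hbr hp hpf, gammaBar,
    ← inCharts_apply (f := f) (φ := φ) hp, DMixed_eq hε hγ hbr hp hpf]
  refine (nabla_low_apply _ _ _ _ (fun b => mpd b (fun v => metricComp η φ (inCharts f φ ψ v) -
    metricComp η φ (inCharts f φ ψ v) * (jac (inCharts f φ ψ) v *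
      ((metricComp (inducedMetric η f) ψ v)⁻¹ * (jac (inCharts f φ ψ) v)ᵀ)) *
      metricComp η φ (inCharts f φ ψ v)) (ψ p)) _ k i j).trans ?_
  simp only [hi.nabla_normal_low hu]
  rfl

end Compatible

open Matrix in
/-- The trace of the tangential projection is the dimension. -/
theorem IsIsometricOn.sum_proj_mul {m n : ℕ} {U : Set (EuclideanSpace ℝ (Fin n))}
    {W : Set (EuclideanSpace ℝ (Fin m))}
    {F : EuclideanSpace ℝ (Fin n) → EuclideanSpace ℝ (Fin m)}
    {G : EuclideanSpace ℝ (Fin n) → Matrix (Fin n) (Fin n) ℝ}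
    {H : EuclideanSpace ℝ (Fin m) → Matrix (Fin m) (Fin m) ℝ} {u : EuclideanSpace ℝ (Fin n)}
    (hi : IsIsometricOn U W F G H) (hu : u ∈ U) :
    ∑ i, ∑ j, (jac F u * ((G u)⁻¹ * (jac F u)ᵀ)) i j * H (F u) i j = n := by
  have h1 : ∑ i, ∑ j, (jac F u * ((G u)⁻¹ * (jac F u)ᵀ)) i j * H (F u) i j =
      ((jac F u * ((G u)⁻¹ * (jac F u)ᵀ)) * (H (F u))ᵀ).trace := by
    simp only [Matrix.trace, Matrix.diag, Matrix.mul_apply, Matrix.transpose_apply]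
  rw [h1, hi.symm_target, Matrix.mul_assoc, Matrix.trace_mul_comm, Matrix.mul_assoc,
    Matrix.mul_assoc, ← hi.metric_eq u hu,
    Matrix.nonsing_inv_mul _ (hi.det_source u hu).isUnit, Matrix.trace_one, Fintype.card_fin]

theorem sum_pullback {m n : ℕ} (Q : Fin m → Fin m → ℝ) (E : Matrix (Fin m) (Fin n) ℝ)
    (x y : Fin n → ℝ) :
    ∑ a, ∑ b, (∑ i, ∑ j, Q i j * E i a * E j b) * x a * y b =
      ∑ i, ∑ j, Q i j * (∑ a, E i a * x a) * (∑ b, E j b * y b) := by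
  have h1 : ∀ i j, Q i j * (∑ a, E i a * x a) * (∑ b, E j b * y b) =
      ∑ a, ∑ b, Q i j * E i a * E j b * x a * y b := by
    intro i j
    rw [mul_assoc, Finset.sum_mul_sum, Finset.mul_sum]
    refine Finset.sum_congr rfl fun a _ => ?_
    rw [Finset.mul_sum]
    exact Finset.sum_congr rfl fun b _ => by ring
  simp only [h1]
  simp only [Finset.sum_mul]
  rw [Finset.sum_congr rfl fun a _ => Finset.sum_comm, Finset.sum_comm]
  refine Finset.sum_congr rfl fun i _ => ?_
  rw [Finset.sum_congr rfl fun a _ => Finset.sum_comm, Finset.sum_comm]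

end BracketGeometry

end

/-! ### The main theorem -/

open BracketGeometry in
theorem mainTheorem5
    {m n N : ℕ}
    {M : Type*} [TopologicalSpace M] [ChartedSpace (EuclideanSpace ℝ (Fin m)) M]
    [IsManifold (𝓡 m) ∞ M]
    {S : Type*} [TopologicalSpace S] [T2Space S] [ChartedSpace (EuclideanSpace ℝ (Fin n)) S]
    [IsManifold (𝓡 n) ∞ S]
    (η : BilinField m M) (hη : IsPseudoRiemannian η)
    (f : S → M) (hf : ContMDiff (𝓡 n) (𝓡 m) ∞ f)
    (hg : ∀ q : S, (inducedMetric (n := n) η f q).Nondegenerate)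
    (br : Bracket n N S)
    (ε : ℝ) (hε : ε = 1 ∨ ε = -1)
    (γ : C^∞⟮𝓡 n, S; ℝ⟯) (hγ : ∀ q, 0 < γ q)
    (φ : OpenPartialHomeomorph M (EuclideanSpace ℝ (Fin m)))
    (hφ : φ ∈ IsManifold.maximalAtlas (𝓡 m) ∞ M)
    (ψ : OpenPartialHomeomorph S (EuclideanSpace ℝ (Fin n)))
    (hψ : ψ ∈ IsManifold.maximalAtlas (𝓡 n) ∞ S)
    (hbr : IsCompatible η f br ε γ φ ψ)
    (p : S) (hpψ : p ∈ ψ.source) (hpφ : f p ∈ φ.source) :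
    -- the Ricci curvature of the submanifold
    (∀ X Y : TangentSpace (𝓡 n) p,
      ricci (inducedMetric η f) ψ p X Y =
        ∑ i, ∑ j,
          (∑ k, ∑ l,
            (DD η f br ε γ φ k l p * RBar η f φ k i l j p
              + dPiUp η f br ε γ φ k k l p * dPiLow η f br ε γ φ j i l p
              - dPiLow η f br ε γ φ k l i p * dPiUp η f br ε γ φ j l k p))
          * vecComp φ (mfderiv (𝓡 n) (𝓡 m) f p X) i
          * vecComp φ (mfderiv (𝓡 n) (𝓡 m) f p Y) j) ∧
    -- the scalar curvature of the submanifold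
    scalarCurvature (inducedMetric η f) ψ p =
        (∑ i, ∑ j, ∑ k, ∑ l,
          DD η f br ε γ φ i j p * DD η f br ε γ φ k l p * RBar η f φ k i l j p)
        + (∑ l, (∑ k, dUpPiLow η f br ε γ φ k k l p) * (∑ i, dPiUp η f br ε γ φ i i l p))
        - (∑ i, ∑ k, ∑ l, dPiLow η f br ε γ φ k i l p * dUpPiUp η f br ε γ φ i k l p) ∧
    -- the bracket expressions in these formulas are the geometric ones:
    -- `𝒟^{ij} = g^{ab} (∂_a x^i) (∂_b x^j)`, `𝒟^i(h) = g^{ab} (∂_a x^i) (∂_b h)`,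
    -- and the factor `γ²` is determined by the bracket
    (∀ i j, DD η f br ε γ φ i j p = gradInner η f ψ (embCoord f φ i) (embCoord f φ j) p) ∧
    (∀ (i : Fin m) (h : S → ℝ), (∀ᶠ q in 𝓝 p, ContMDiffAt (𝓡 n) 𝓘(ℝ) ∞ h q) →
      DOpUp η f br ε γ φ i h p = gradInner η f ψ (embCoord f φ i) h p) ∧
    (n : ℝ) * γ p ^ 2 =
      ε * ∑ i, ∑ j, ∑ I : Fin N → Fin m, ∑ J : Fin N → Fin m,
        PP br f φ i I p * PP br f φ j J p * etaMulti η f φ I J p * etaLow η f φ i j p := by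
  have hi := isIsometricOn hf hφ hψ hη hg
  have hu := mem_commonDomain hpψ hpφ
  have hF : inCharts f φ ψ (ψ p) = φ (f p) := inCharts_apply hpψ
  have hε2 : ε * ε = 1 := by rcases hε with rfl | rfl <;> norm_num
  refine ⟨fun X Y => ?_, ?_, DD_eq_gradInner hε (hγ p) hbr hpψ hpφ,
    fun i h hh => DOpUp_eq_gradInner hη hf hg hε (hγ p) hφ hψ hbr hpψ hpφ i hh, ?_⟩
  · simp only [ricci, hi.ricciComp_eq hu, DD_eq hε hγ hbr hpψ hpφ, RBar,
      dPiUp_eq hη hf hg hε hγ hφ hψ hbr hpψ hpφ, dPiLow_eq hη hf hg hε hγ hφ hψ hbr hpψ hpφ,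
      vecComp_mfderiv hf hφ hψ hpψ hpφ, hF]
    exact sum_pullback _ _ _ _
  · rw [scalarCurvature, hi.scalar_eq hu]
    simp only [DD_eq hε hγ hbr hpψ hpφ, RBar, dUpPiLow, dUpPiUp, etaUp,
      dPiUp_eq hη hf hg hε hγ hφ hψ hbr hpψ hpφ, dPiLow_eq hη hf hg hε hγ hφ hψ hbr hpψ hpφ, hF]
  -- The trace of the tangential projection is `n`, and the outer `ε` cancels the one from
  -- compatibility.
  · have h1 : ∀ i j, ∑ I : Fin N → Fin m, ∑ J : Fin N → Fin m,
        PP br f φ i I p * PP br f φ j J p * etaMulti η f φ I J p * etaLow η f φ i j p =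
        ε * γ p ^ 2 * ((jac (inCharts f φ ψ) (ψ p) *
          ((metricComp (inducedMetric η f) ψ (ψ p))⁻¹ *
            (jac (inCharts f φ ψ) (ψ p)).transpose)) i j *
          metricComp η φ (inCharts f φ ψ (ψ p)) i j) := by
      intro i j
      rw [← gradInner_embCoord, ← mul_assoc, ← hbr p hpψ hpφ i j, hF]
      simp only [Finset.sum_mul, etaLow]
    simp only [h1, ← Finset.mul_sum]
    rw [hi.sum_proj_mul hu, ← mul_assoc, ← mul_assoc, hε2]
    ring
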